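/- Let $\sigma(z)=\max\{0,z\}$, applied coordinatewise. A (ReLU) neural network of depth $L\ge 1$ with input dimension $d\ge1$ is a function $\mathcal N:\mathbb R^d\to\mathbb R$ given, with $\mathbf h^{(0)}=\mathbf x$ and $n_0=d$, by $\mathbf h^{(i)}=\sigma(W^{(i)}\mathbf h^{(i-1)}+\mathbf b^{(i)})$ for $1\le i\le L-1$ and $\mathcal N(\mathbf x)=W^{(L)}\mathbf h^{(L-1)}+\mathbf b^{(L)}$, where $W^{(i)}\in\mathbb R^{n_i\times n_{i-1}}$, $\mathbf b^{(i)}\in\mathbb R^{n_i}$, $n_i\ge 1$ and $n_L=1$. Its width is $\max\{d,n_1,\dots,n_{L-1}\}$, its weights are all entries of the matrices $W^{(i)}$ and of the bias vectors $\mathbf b^{(i)}$, and its number of parameters is the total number of these entries (zero entries included). **Corollary 3.2.** There is an absolute constant $C>0$ such that the following holds. Let $A,B,n,L,d\ge 1$ be integers, let $\varepsilon,\delta,\beta>0$, and let $\mathcal N_0$ be a neural network with input dimension $d$, width $n$, depth $L$ and all weights in $[-B,B]$. Let $\mathcal D$ be a probability distribution on $[-A,A]^d$ with a density function $p_{\mathcal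 D}$ such that $p_{\mathcal D}(\mathbf x)\le\beta$ for every $\mathbf x\in[-A,A]^d$. Put $$\Lambda=\log\Big(2\,A\,B\,n\cdot\max\{1,\beta\}\cdot\max\{1,\varepsilon^{-1}\}\cdot\max\{1,\delta^{-1}\}\Big),$$ which is $\log\big(2ABn\beta/(\varepsilon\delta)\big)$ when $\beta\ge1$ and $\varepsilon,\delta\le1$. Then there exists a neural network $\mathcal N$ with input dimension $d$, width at most $\max\{5d,10\}$, all weights in $[-2,2]$, depth at most $C\,n^3L^3\Lambda^2$ and at most $C\,n^3L^3\Lambda^2$ parameters, such that $$\Pr_{\mathbf x\sim\mathcal D}\big[\,|\mathcal N(\mathbf x)-\mathcal N_0(\mathbf x)|\le\varepsilon\,\big]>1-\delta .$$ -/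

import Mathlib

/-- The ReLU activation `σ(z) = max {0, z}`. -/
noncomputable def relu (z : ℝ) : ℝ := max 0 z

/-- A fully connected ReLU network with `d` inputs and one real output, given by its weights and
biases, from the input side to the output side.  `hidden W b N` feeds `σ(W x + b)` (a nonempty
layer of `m` neurons) into the remaining network `N`; `output w b` is the last layer
`x ↦ ⟨w, x⟩ + b`, which has no activation. -/
inductive ReLUNet : ℕ → Type
  | output {d : ℕ} (w : Fin d → ℝ) (b : ℝ) : ReLUNet d
  | hidden {d m : ℕ} (hm : 0 < m) (W : Matrix (Fin m) (Fin d) ℝ) (b : Fin m → ℝ)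
      (N : ReLUNet m) : ReLUNet d

namespace ReLUNet

/-- The function computed by a network. -/
noncomputable def eval : {d : ℕ} → ReLUNet d → (Fin d → ℝ) → ℝ
  | _, output w b, x => ∑ j, w j * x j + b
  | _, hidden _ W b N, x => N.eval (fun i => relu (∑ j, W i j * x j + b i))

/-- The depth: the number of layers, the output layer included. -/
def depth : {d : ℕ} → ReLUNet d → ℕ
  | _, output _ _ => 1
  | _, hidden _ _ _ N => N.depth + 1

/-- The width: the maximum of the input dimension and of the sizes of all hidden layers. -/
def width : {d : ℕ} → ReLUNet d → ℕ
  | d, output _ _ => d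
  | d, hidden _ _ _ N => max d N.width

/-- The number of parameters: the number of entries, zero or not, of all weight matrices and
bias vectors. -/
def numParams : {d : ℕ} → ReLUNet d → ℕ
  | d, output _ _ => d + 1
  | d, hidden (m := m) _ _ _ N => m * d + m + N.numParams

/-- All entries of all weight matrices and bias vectors lie in `[-M, M]`. -/
def WeightsBoundedBy (M : ℝ) : {d : ℕ} → ReLUNet d → Prop
  | _, output w b => (∀ j, |w j| ≤ M) ∧ |b| ≤ M
  | _, hidden _ W b N => (∀ i j, |W i j| ≤ M) ∧ (∀ i, |b i| ≤ M) ∧ N.WeightsBoundedBy M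

end ReLUNet

/-- The cube `[-A, A]^d`. -/
def cube (d : ℕ) (A : ℝ) : Set (Fin d → ℝ) := Set.Icc (fun _ => -A) (fun _ => A)

/-- `D` is a probability distribution on `[-A, A]^d` with density function `p` (with respect to
Lebesgue measure) that is at most `β` everywhere on `[-A, A]^d`. -/
structure HasBoundedDensityOnCube {d : ℕ} (D : MeasureTheory.Measure (Fin d → ℝ)) (A : ℝ)
    (p : (Fin d → ℝ) → ℝ) (β : ℝ) : Prop where
  isProbabilityMeasure : MeasureTheory.IsProbabilityMeasure D
  measurable : Measurable p
  nonneg : ∀ x ∈ cube d A, 0 ≤ p x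
  le_bound : ∀ x ∈ cube d A, p x ≤ β
  eq_withDensity : D = (MeasureTheory.volume.restrict (cube d A)).withDensity
    (fun x => ENNReal.ofReal (p x))

/-!
# Approximating ReLU networks by narrow ones

The narrow network does not store the neurons of a layer of `N₀` separately. It stores a whole layer
as a single real number, `pack c t`, whose binary expansion is the concatenation of the (shifted,
hence nonnegative) preactivations, rounded to integers of `c` digits. Since packing is linear, the
contribution of one neuron to *all* preactivations of the next layer is one constant (a packed
column of the weight matrix) times the activation of that neuron (`sum_mul_pack_add_pack`). So it
suffices to read the packed number digit by digit from the left and to add, for every digit that is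
one, a fixed constant to an accumulator; at the end of the layer the accumulator is the packed next
layer. The rectifier costs nothing: the leading digit of a block is the sign, and it is kept as a
gate that suppresses the remaining digits of the block (`exists_runs_addBlock`). Dropping the last
digits of a block rounds the activation, so the block length `c` need not grow with the layer.

A leading binary digit is read by the ramp `2 ^ s * (z - 1 / 2) + 1`, clipped to `[0, 1]`, which
takes `s + O(1)` layers with weights in `[-2, 2]`. On multiples of `2 ^ (-s)` it is exact (`rampAvoiding_of_dyadic`),
so the simulation of `N₀` makes no errors beyond rounding (`round_neuron`,
`exists_realizes_simulation`). The real inputs are read in the same way, all coordinates in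
parallel; there the ramp fails only on thin slabs just below dyadic rationals, and the bounded
density makes their total mass smaller than `δ` (`HasBoundedDensityOnCube.one_sub_le_measureReal`,
`exceptional_lt`).

With `lam` of order `Λ`, blocks have `O(L * lam)` digits. Reading the inputs takes
`O(L * lam) * O(n * L * lam)` layers of width `2 * d + 3`, and each layer of `N₀` takes
`O(n * L * lam) ^ 2` layers of width `5`, which gives the stated bounds (`size_le`).
-/

/-! ### Layers and realizable functions -/

/-- A map between coordinate spaces over arbitrary index types that a single ReLU layer with
weights in `[-2, 2]` computes. -/
def IsLayer {ι κ : Type*} [Fintype ι] (f : (ι → ℝ) → (κ → ℝ)) : Prop :=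
  ∃ (W : κ → ι → ℝ) (b : κ → ℝ), (∀ i j, |W i j| ≤ 2) ∧ (∀ i, |b i| ≤ 2) ∧
    ∀ x i, f x i = relu (∑ j, W i j * x j + b i)

/-- `Runs T f` says that `f` is a composition of `T` layers that all have the neurons `ι`. -/
inductive Runs {ι : Type*} [Fintype ι] : ℕ → ((ι → ℝ) → (ι → ℝ)) → Prop
  | refl : Runs 0 id
  | step {T : ℕ} {f g : (ι → ℝ) → (ι → ℝ)} (hf : Runs T f) (hg : IsLayer g) :
      Runs (T + 1) (g ∘ f)

/-- `F` is computed by a network of width at most `w`, depth at most `T`, with at most `P`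
parameters and all weights in `[-2, 2]`, whose inputs are numbered by `e`. -/
def Realizes {ι : Type*} {a : ℕ} (e : ι ≃ Fin a) (w T P : ℕ) (F : (ι → ℝ) → ℝ) : Prop :=
  ∃ N : ReLUNet a, N.width ≤ w ∧ N.WeightsBoundedBy 2 ∧ N.depth ≤ T ∧ N.numParams ≤ P ∧
    ∀ x, N.eval (x ∘ e.symm) = F x

lemma relu_nonneg (x : ℝ) : 0 ≤ relu x := le_max_left _ _

lemma relu_of_nonneg {x : ℝ} (h : 0 ≤ x) : relu x = x := max_eq_right h

lemma relu_of_nonpos {x : ℝ} (h : x ≤ 0) : relu x = 0 := max_eq_left h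

lemma abs_relu_sub_relu_le (x y : ℝ) : |relu x - relu y| ≤ |x - y| := by
  unfold relu
  rw [max_comm 0 x, max_comm 0 y]
  exact abs_max_sub_max_le_abs x y 0

namespace Runs

variable {ι : Type*} [Fintype ι]

lemma single {f : (ι → ℝ) → (ι → ℝ)} (hf : IsLayer f) : Runs 1 f :=
  Runs.step Runs.refl hf

lemma trans {T T' : ℕ} {f g : (ι → ℝ) → (ι → ℝ)} (hf : Runs T f) (hg : Runs T' g) :
    Runs (T + T') (g ∘ f) := by
  induction hg with
  | refl => exact hf
  | step _ hk ih => exact Runs.step (f := _ ∘ f) ih hk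

lemma iterate {f : (ι → ℝ) → (ι → ℝ)} (hf : IsLayer f) (T : ℕ) : Runs T f^[T] := by
  induction T with
  | zero => exact Runs.refl
  | succ T ih => rw [Function.iterate_succ']; exact ih.step hf

end Runs

namespace Realizes

variable {ι κ : Type*} {a a' : ℕ} {e : ι ≃ Fin a} {e' : κ ≃ Fin a'} {w T P : ℕ}

lemma mono {F : (ι → ℝ) → ℝ} (h : Realizes e w T P F) {w' T' P' : ℕ}
    (hw : w ≤ w') (hT : T ≤ T') (hP : P ≤ P') : Realizes e w' T' P' F := by
  obtain ⟨N, h1, h2, h3, h4, h5⟩ := h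
  exact ⟨N, h1.trans hw, h2, h3.trans hT, h4.trans hP, h5⟩

lemma layer [Fintype ι] {F : (κ → ℝ) → ℝ} (h : Realizes e' w T P F) {f : (ι → ℝ) → (κ → ℝ)}
    (hf : IsLayer f) (ha : a ≤ w) (ha' : 0 < a') :
    Realizes e w (T + 1) (a' * a + a' + P) (F ∘ f) := by
  obtain ⟨N, h1, h2, h3, h4, h5⟩ := h
  obtain ⟨W, b, hW, hb, hf⟩ := hf
  refine ⟨.hidden ha' (fun i j => W (e'.symm i) (e.symm j)) (fun i => b (e'.symm i)) N,
    ?_, ⟨fun i j => hW _ _, fun i => hb _, h2⟩, ?_, ?_, fun x => ?_⟩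
  · simpa [ReLUNet.width] using ⟨ha, h1⟩
  · simpa [ReLUNet.depth] using h3
  · simpa [ReLUNet.numParams] using h4
  · simp only [ReLUNet.eval, Function.comp_apply]
    rw [← h5]
    congr 1
    funext i
    simp only [Function.comp_apply, hf]
    congr 2
    exact Equiv.sum_comp e.symm (fun j => W (e'.symm i) j * x j)

lemma runs [Fintype ι] {F : (ι → ℝ) → ℝ} (h : Realizes e w T P F) {f : (ι → ℝ) → (ι → ℝ)} {T' : ℕ}
    (hf : Runs T' f) (haw : a ≤ w) (ha : 0 < a) :
    Realizes e w (T + T') (P + T' * (a * a + a)) (F ∘ f) := by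
  induction hf generalizing F T P with
  | refl => simpa using h
  | step _ hg ih =>
    have := ih (h.layer (e := e) hg haw ha)
    refine this.mono le_rfl (by omega) (le_of_eq (by ring))

end Realizes

/-! ### The register machine -/

/-- The registers of the machine: the fractional parts `z`, the scratch registers `y`, and the
three scalars `σ` (gate) and `p`, `m` (positive and negative part of the accumulator). -/
abbrev Reg (d : ℕ) : Type := Fin d ⊕ Fin d ⊕ Fin 3

/-- The numbering of the registers. -/
noncomputable def regEquiv (d : ℕ) : Reg d ≃ Fin (2 * d + 3) :=
  Fintype.equivFinOfCardEq (by simp; ring)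

/-- The register contents with given entries. -/
def regs {d : ℕ} (z y : Fin d → ℝ) (σ p m : ℝ) : Reg d → ℝ :=
  Sum.elim z (Sum.elim y ![σ, p, m])

/-- The layers that the machine uses, with all their coefficients left open: every register is
updated in the same way for all coordinates, and the scratch registers feed the accumulator. -/
lemma isLayer_regs {d : ℕ} {z₁ z₂ z₃ y₁ y₂ y₃ y₄ s₁ s₂ s₃ r t t' : ℝ} {u u' : Fin d → ℝ}
    (hz₁ : |z₁| ≤ 2) (hz₂ : |z₂| ≤ 2) (hz₃ : |z₃| ≤ 2)
    (hy₁ : |y₁| ≤ 2) (hy₂ : |y₂| ≤ 2) (hy₃ : |y₃| ≤ 2) (hy₄ : |y₄| ≤ 2)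
    (hs₁ : |s₁| ≤ 2) (hs₂ : |s₂| ≤ 2) (hs₃ : |s₃| ≤ 2) (hr : |r| ≤ 2)
    (ht : |t| ≤ 2) (ht' : |t'| ≤ 2) (hu : ∀ j, |u j| ≤ 2) (hu' : ∀ j, |u' j| ≤ 2) :
    ∃ f : (Reg d → ℝ) → (Reg d → ℝ), IsLayer f ∧ ∀ z y σ p m, f (regs z y σ p m) =
      regs (fun j => relu (z₁ * z j + z₂ * y j + z₃))
        (fun j => relu (y₁ * z j + y₂ * y j + y₃ * σ + y₄))
        (relu (s₁ * σ + s₂ * ∑ j, y j + s₃))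
        (relu (r * p + ∑ j, u j * y j + t))
        (relu (r * m + ∑ j, u' j * y j + t')) := by
  classical
  let W : Reg d → Reg d → ℝ :=
    Sum.elim (fun i => Sum.elim (Pi.single i z₁) (Sum.elim (Pi.single i z₂) ![0, 0, 0]))
      (Sum.elim (fun i => Sum.elim (Pi.single i y₁) (Sum.elim (Pi.single i y₂) ![y₃, 0, 0]))
        ![Sum.elim 0 (Sum.elim (fun _ => s₂) ![s₁, 0, 0]),
          Sum.elim 0 (Sum.elim u ![0, r, 0]),
          Sum.elim 0 (Sum.elim u' ![0, 0, r])])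
  let b : Reg d → ℝ := Sum.elim (fun _ => z₃) (Sum.elim (fun _ => y₄) ![s₃, t, t'])
  have hsingle : ∀ (i j : Fin d) (c : ℝ), |c| ≤ 2 → |(Pi.single i c : Fin d → ℝ) j| ≤ 2 := by
    intro i j c hc
    by_cases h : j = i
    · subst h; simpa using hc
    · simp [h]
  refine ⟨fun x i => relu (∑ j, W i j * x j + b i), ⟨W, b, ?_, ?_, fun _ _ => rfl⟩, ?_⟩
  · rintro (i | i | i) (j | j | j)
    · exact hsingle _ _ _ hz₁
    · exact hsingle _ _ _ hz₂
    · fin_cases j <;> simp [W]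
    · exact hsingle _ _ _ hy₁
    · exact hsingle _ _ _ hy₂
    · fin_cases j <;> simp [W, hy₃]
    · fin_cases i <;> simp [W]
    · fin_cases i <;> simp [W, hs₂, hu, hu']
    · fin_cases i <;> fin_cases j <;> simp [W, hs₁, hr]
  · rintro (i | i | i)
    · simpa [b] using hz₃
    · simpa [b] using hy₄
    · fin_cases i <;> simp [b, hs₃, ht, ht']
  · intro z y σ p m
    funext i
    rcases i with (i | i | i)
    · simp [W, b, regs, Fintype.sum_sum_type, Fin.sum_univ_three, Pi.single_apply, ite_mul]
    · simp [W, b, regs, Fintype.sum_sum_type, Fin.sum_univ_three, Pi.single_apply, ite_mul,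
        add_assoc]
    · fin_cases i <;>
      simp [W, b, regs, Fintype.sum_sum_type, Fin.sum_univ_three, Finset.mul_sum] <;>
      congr 1 <;> ring

/-! ### Extracting binary digits -/

/-- The first `l` binary digits of `z` are read off exactly by ramps of slope `2 ^ s`: at no stage
does the current fractional part lie on the ramp, immediately below `1 / 2`. -/
def RampAvoiding (s l : ℕ) (z : ℝ) : Prop :=
  ∀ t < l, Int.fract (2 ^ t * z) ∉ Set.Ioo (1 / 2 - 1 / 2 ^ s : ℝ) (1 / 2)

lemma fract_two_pow_mul_fract (l : ℕ) (w : ℝ) :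
    Int.fract (2 ^ l * Int.fract w) = Int.fract (2 ^ l * w) := by
  have h : (2 : ℝ) ^ l * w = 2 ^ l * Int.fract w + ((2 ^ l * ⌊w⌋ : ℤ) : ℝ) := by
    push_cast
    rw [← mul_add, Int.fract_add_floor]
  rw [h, Int.fract_add_intCast]

lemma floor_two_pow_succ_mul (l : ℕ) (w : ℝ) :
    (⌊2 ^ (l + 1) * w⌋ : ℝ) = 2 ^ l * ⌊2 * w⌋ + ⌊2 ^ l * Int.fract (2 * w)⌋ := by
  have h : (2 : ℝ) ^ (l + 1) * w = 2 ^ l * Int.fract (2 * w) + ((2 ^ l * ⌊2 * w⌋ : ℤ) : ℝ) := by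
    push_cast
    rw [← mul_add, Int.fract_add_floor]
    ring
  rw [h, Int.floor_add_intCast]
  push_cast
  ring

lemma RampAvoiding.fract_two_mul {s l : ℕ} {z : ℝ} (h : RampAvoiding s (l + 1) z) :
    RampAvoiding s l (Int.fract (2 * z)) := by
  intro t ht
  have := h (t + 1) (by omega)
  rwa [fract_two_pow_mul_fract, ← mul_assoc, ← pow_succ]

lemma RampAvoiding.notMem {s l : ℕ} {z : ℝ} (h : RampAvoiding s (l + 1) z) (h0 : 0 ≤ z)
    (h1 : z < 1) : z ∉ Set.Ioo (1 / 2 - 1 / 2 ^ s : ℝ) (1 / 2) := by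
  have := h 0 (by omega)
  rwa [pow_zero, one_mul, Int.fract_eq_self.2 ⟨h0, h1⟩] at this

lemma exists_fract_mul_two_pow_eq {s : ℕ} (t : ℕ) {z : ℝ} {K : ℤ} (h : z * 2 ^ s = K) :
    ∃ k : ℤ, Int.fract (2 ^ t * z) * 2 ^ s = k := by
  refine ⟨2 ^ t * K - ⌊2 ^ t * z⌋ * 2 ^ s, ?_⟩
  push_cast
  rw [← h, ← Int.self_sub_floor]
  ring

/-- Multiples of `2 ^ (-s)` avoid the ramps of slope `2 ^ s`. -/
lemma rampAvoiding_of_dyadic {s : ℕ} (l : ℕ) (hs1 : 0 < s) {z : ℝ} {K : ℤ} (h : z * 2 ^ s = K) :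
    RampAvoiding s l z := by
  rintro t - ⟨h1, h2⟩
  set w := Int.fract (2 ^ t * z)
  obtain ⟨k, hk⟩ : ∃ k : ℤ, w * 2 ^ s = k := exists_fract_mul_two_pow_eq t h
  have hs : (0 : ℝ) < 2 ^ s := by positivity
  have h3 : (k : ℝ) * 2 < 2 ^ s := by rw [← hk]; nlinarith
  have h4 : (2 : ℝ) ^ s < k * 2 + 2 := by
    rw [← hk]
    have : (1 / 2 - 1 / 2 ^ s) * 2 ^ s < w * 2 ^ s := by gcongr
    have h5 : (1 / 2 - 1 / 2 ^ s : ℝ) * 2 ^ s = 2 ^ s / 2 - 1 := by field_simp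
    linarith
  obtain ⟨r, rfl⟩ := Nat.exists_eq_add_of_lt hs1
  have h3' : k * 2 < 2 ^ (0 + r + 1) := by exact_mod_cast h3
  have h4' : (2 : ℤ) ^ (0 + r + 1) < k * 2 + 2 := by exact_mod_cast h4
  rw [pow_succ] at h3' h4'
  omega

/-- The ramp of slope `2 ^ s` below `1 / 2` reads off the leading binary digit of `z`. -/
lemma relu_ramp {s : ℕ} {z : ℝ} (h0 : 0 ≤ z) (h1 : z < 1)
    (h : z ∉ Set.Ioo (1 / 2 - 1 / 2 ^ s : ℝ) (1 / 2)) :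
    relu (1 - 2 ^ s * relu (z - 1 / 2 + 1 / 2 ^ s)) = 1 - ⌊2 * z⌋ := by
  have hs : (0 : ℝ) < 2 ^ s := by positivity
  by_cases hz : 1 / 2 ≤ z
  · have hf : ⌊2 * z⌋ = 1 := by
      rw [Int.floor_eq_iff]; push_cast; constructor <;> linarith
    have h2 : (0 : ℝ) < 1 / 2 ^ s := by positivity
    rw [relu_of_nonneg (x := z - 1 / 2 + 1 / 2 ^ s) (by linarith), relu_of_nonpos, hf]
    · simp
    · have : (1 : ℝ) ≤ 2 ^ s * (z - 1 / 2 + 1 / 2 ^ s) := by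
        have h3 : (2 : ℝ) ^ s * (1 / 2 ^ s) = 1 := by field_simp
        nlinarith
      linarith
  · have hf : ⌊2 * z⌋ = 0 := by
      rw [Int.floor_eq_iff]; push_cast; constructor <;> linarith
    have h2 : z ≤ 1 / 2 - 1 / 2 ^ s := by
      by_contra hc
      exact h ⟨by linarith, by linarith⟩
    rw [relu_of_nonpos (x := z - 1 / 2 + 1 / 2 ^ s) (by linarith), relu_of_nonneg (by simp), hf]
    simp

/-- Reading the leading digit: `s` doublings build a ramp of slope `2 ^ s`, and the scratch register
ends up holding the complement of the digit. -/
lemma exists_runs_digit (d s : ℕ) :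
    ∃ f : (Reg d → ℝ) → (Reg d → ℝ), Runs (s + 2) f ∧
      ∀ z σ p m, (∀ j, 0 ≤ z j) → (∀ j, z j < 1) → 0 ≤ σ → 0 ≤ p → 0 ≤ m →
        (∀ j, z j ∉ Set.Ioo (1 / 2 - 1 / 2 ^ s : ℝ) (1 / 2)) →
        f (regs z 0 σ p m) = regs z (fun j => 1 - ⌊2 * z j⌋) σ p m := by
  have hs : |(1 / 2 ^ s - 1 / 2 : ℝ)| ≤ 2 := by
    have h1 : (0 : ℝ) ≤ 1 / 2 ^ s := by positivity
    have h2 : (1 : ℝ) / 2 ^ s ≤ 1 := by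
      rw [div_le_one (by positivity)]; exact one_le_pow₀ (by norm_num)
    rw [abs_le]; constructor <;> linarith
  obtain ⟨f₁, hf₁, e₁⟩ := isLayer_regs (d := d) (z₁ := 1) (z₂ := 0) (z₃ := 0) (y₁ := 1) (y₂ := 0)
    (y₃ := 0) (y₄ := 1 / 2 ^ s - 1 / 2) (s₁ := 1) (s₂ := 0) (s₃ := 0) (r := 1) (t := 0) (t' := 0)
    (u := 0) (u' := 0) (by simp) (by simp) (by simp) (by simp) (by simp) (by simp) hs (by simp)
    (by simp) (by simp) (by simp) (by simp) (by simp) (by simp) (by simp)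
  obtain ⟨f₂, hf₂, e₂⟩ := isLayer_regs (d := d) (z₁ := 1) (z₂ := 0) (z₃ := 0) (y₁ := 0) (y₂ := 2)
    (y₃ := 0) (y₄ := 0) (s₁ := 1) (s₂ := 0) (s₃ := 0) (r := 1) (t := 0) (t' := 0)
    (u := 0) (u' := 0) (by simp) (by simp) (by simp) (by simp) (by simp) (by simp) (by simp)
    (by simp) (by simp) (by simp) (by simp) (by simp) (by simp) (by simp) (by simp)
  obtain ⟨f₃, hf₃, e₃⟩ := isLayer_regs (d := d) (z₁ := 1) (z₂ := 0) (z₃ := 0) (y₁ := 0) (y₂ := -1)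
    (y₃ := 0) (y₄ := 1) (s₁ := 1) (s₂ := 0) (s₃ := 0) (r := 1) (t := 0) (t' := 0)
    (u := 0) (u' := 0) (by simp) (by simp) (by simp) (by simp) (by simp) (by simp) (by simp)
    (by simp) (by simp) (by simp) (by simp) (by simp) (by simp) (by simp) (by simp)
  refine ⟨f₃ ∘ f₂^[s] ∘ f₁, ?_, ?_⟩
  · have := ((Runs.single hf₁).trans (Runs.iterate hf₂ s)).trans (Runs.single hf₃)
    rwa [show 1 + s + 1 = s + 2 by ring] at this
  · intro z σ p m hz hz1 hσ hp hm hav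
    have hit : ∀ k : ℕ, f₂^[k] (f₁ (regs z 0 σ p m)) =
        regs z (fun j => 2 ^ k * relu (z j - 1 / 2 + 1 / 2 ^ s)) σ p m := by
      intro k
      induction k with
      | zero =>
        simp only [Function.iterate_zero, id, e₁]
        simp only [Pi.zero_apply, one_mul, zero_mul, mul_zero, add_zero, Finset.sum_const_zero,
          relu_of_nonneg hσ, relu_of_nonneg hp, relu_of_nonneg hm, relu_of_nonneg (hz _), pow_zero,
          sub_add_eq_add_sub, add_sub_assoc]
      | succ k ih =>
        rw [Function.iterate_succ_apply', ih, e₂]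
        simp only [Pi.zero_apply, one_mul, zero_mul, add_zero, Finset.sum_const_zero,
          relu_of_nonneg hσ, relu_of_nonneg hp, relu_of_nonneg hm, relu_of_nonneg (hz _), zero_add]
        congr 1
        funext j
        rw [relu_of_nonneg (by have := relu_nonneg (z j - 1 / 2 + 1 / 2 ^ s); positivity), pow_succ]
        ring
    simp only [Function.comp_apply, hit, e₃]
    simp only [Pi.zero_apply, one_mul, zero_mul, add_zero, Finset.sum_const_zero,
      relu_of_nonneg hσ, relu_of_nonneg hp, relu_of_nonneg hm, relu_of_nonneg (hz _), zero_add,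
      neg_mul, neg_add_eq_sub]
    congr 1
    funext j
    exact relu_ramp (hz j) (hz1 j) (hav j)

lemma floor_two_mul_eq_zero_or_one {z : ℝ} (h0 : 0 ≤ z) (h1 : z < 1) :
    ⌊2 * z⌋ = 0 ∨ ⌊2 * z⌋ = 1 := by
  have h2 : 0 ≤ ⌊2 * z⌋ := Int.floor_nonneg.2 (by linarith)
  have h3 : ⌊2 * z⌋ < 2 := Int.floor_lt.2 (by push_cast; linarith)
  omega

lemma relu_shift_eq_fract (z : ℝ) : relu (2 * z + (1 - ⌊2 * z⌋) + -1) = Int.fract (2 * z) := by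
  rw [← Int.self_sub_floor, relu_of_nonneg]
  · ring
  · have := Int.floor_le (2 * z); linarith

/-- One leading digit of every `z j` is removed and, if the gate `σ` is open, added with weight
`u j` to the accumulator. -/
lemma exists_runs_addDigit (d s : ℕ) (u : Fin d → ℝ) (hu : ∀ j, |u j| ≤ 2) :
    ∃ f : (Reg d → ℝ) → (Reg d → ℝ), Runs (s + 4) f ∧
      ∀ z σ p m, (∀ j, 0 ≤ z j) → (∀ j, z j < 1) → (σ = 0 ∨ σ = 1) → 0 ≤ p → 0 ≤ m →
        (∀ j, z j ∉ Set.Ioo (1 / 2 - 1 / 2 ^ s : ℝ) (1 / 2)) →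
        ∃ p' m', 0 ≤ p' ∧ 0 ≤ m' ∧
          f (regs z 0 σ p m) = regs (fun j => Int.fract (2 * z j)) 0 σ p' m' ∧
          p' - m' = p - m + σ * ∑ j, u j * ⌊2 * z j⌋ := by
  obtain ⟨f₀, hf₀, e₀⟩ := exists_runs_digit d s
  obtain ⟨f₁, hf₁, e₁⟩ := isLayer_regs (d := d) (z₁ := 2) (z₂ := 1) (z₃ := -1) (y₁ := 0) (y₂ := -1)
    (y₃ := 1) (y₄ := 0) (s₁ := 1) (s₂ := 0) (s₃ := 0) (r := 1) (t := 0) (t' := 0)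
    (u := 0) (u' := 0) (by simp) (by simp) (by simp) (by simp) (by simp) (by simp) (by simp)
    (by simp) (by simp) (by simp) (by simp) (by simp) (by simp) (by simp) (by simp)
  have hu₁ : ∀ j, |max (u j) 0| ≤ 2 := fun j => by
    rw [abs_of_nonneg (le_max_right _ _)]
    exact max_le ((le_abs_self _).trans (hu j)) (by norm_num)
  have hu₂ : ∀ j, |max (-u j) 0| ≤ 2 := fun j => by
    rw [abs_of_nonneg (le_max_right _ _)]
    exact max_le ((neg_le_abs _).trans (hu j)) (by norm_num)
  obtain ⟨f₂, hf₂, e₂⟩ := isLayer_regs (d := d) (z₁ := 1) (z₂ := 0) (z₃ := 0) (y₁ := 0) (y₂ := 0)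
    (y₃ := 0) (y₄ := 0) (s₁ := 1) (s₂ := 0) (s₃ := 0) (r := 1) (t := 0) (t' := 0)
    (u := fun j => max (u j) 0) (u' := fun j => max (-u j) 0)
    (by simp) (by simp) (by simp) (by simp) (by simp) (by simp) (by simp)
    (by simp) (by simp) (by simp) (by simp) (by simp) (by simp) hu₁ hu₂
  refine ⟨f₂ ∘ f₁ ∘ f₀, ?_, ?_⟩
  · exact (hf₀.trans (Runs.single hf₁)).trans (Runs.single hf₂)
  · intro z σ p m hz hz1 hσ hp hm hav
    have hσ0 : 0 ≤ σ := by rcases hσ with rfl | rfl <;> norm_num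
    have hg : ∀ j, relu (-(1 - (⌊2 * z j⌋ : ℝ)) + σ) = σ * ⌊2 * z j⌋ := by
      intro j
      rcases floor_two_mul_eq_zero_or_one (hz j) (hz1 j) with h | h <;>
        rcases hσ with rfl | rfl <;> simp [h, relu]
    have hg0 : ∀ j, 0 ≤ σ * (⌊2 * z j⌋ : ℝ) := fun j => (hg j) ▸ relu_nonneg _
    have hp' : 0 ≤ p + ∑ j, max (u j) 0 * (σ * ⌊2 * z j⌋) :=
      add_nonneg hp (Finset.sum_nonneg fun j _ => mul_nonneg (le_max_right _ _) (hg0 j))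
    have hm' : 0 ≤ m + ∑ j, max (-u j) 0 * (σ * ⌊2 * z j⌋) :=
      add_nonneg hm (Finset.sum_nonneg fun j _ => mul_nonneg (le_max_right _ _) (hg0 j))
    refine ⟨_, _, hp', hm', ?_, ?_⟩
    · simp only [Function.comp_apply, e₀ z σ p m hz hz1 hσ0 hp hm hav, e₁, e₂]
      simp only [Pi.zero_apply, one_mul, zero_mul, add_zero, Finset.sum_const_zero,
        relu_of_nonneg hσ0, relu_of_nonneg hp, relu_of_nonneg hm, zero_add, neg_mul, hg,
        relu_of_nonneg hp', relu_of_nonneg hm', relu_shift_eq_fract,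
        relu_of_nonneg (Int.fract_nonneg _), relu_of_nonneg le_rfl]
      rfl
    · have h : ∀ j, u j = max (u j) 0 - max (-u j) 0 := fun j => by
        rcases le_total (u j) 0 with h | h <;> simp [h]
      have h2 : ∑ j, u j * (⌊2 * z j⌋ : ℝ) =
          ∑ j, max (u j) 0 * (⌊2 * z j⌋ : ℝ) - ∑ j, max (-u j) 0 * (⌊2 * z j⌋ : ℝ) := by
        rw [← Finset.sum_sub_distrib]
        refine Finset.sum_congr rfl fun j _ => ?_
        rw [← sub_mul, ← h]
      rw [h2, mul_sub, Finset.mul_sum, Finset.mul_sum]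
      simp only [mul_left_comm σ]
      ring

/-- The leading digit becomes the gate. -/
lemma exists_runs_setGate (s : ℕ) :
    ∃ f : (Reg 1 → ℝ) → (Reg 1 → ℝ), Runs (s + 4) f ∧
      ∀ z σ p m, 0 ≤ z → z < 1 → 0 ≤ σ → 0 ≤ p → 0 ≤ m →
        z ∉ Set.Ioo (1 / 2 - 1 / 2 ^ s : ℝ) (1 / 2) →
        f (regs (fun _ => z) 0 σ p m) =
          regs (fun _ => Int.fract (2 * z)) 0 ⌊2 * z⌋ p m := by
  obtain ⟨f₀, hf₀, e₀⟩ := exists_runs_digit 1 s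
  obtain ⟨f₁, hf₁, e₁⟩ := isLayer_regs (d := 1) (z₁ := 2) (z₂ := 1) (z₃ := -1) (y₁ := 0) (y₂ := 0)
    (y₃ := 0) (y₄ := 0) (s₁ := 0) (s₂ := -1) (s₃ := 1) (r := 1) (t := 0) (t' := 0)
    (u := 0) (u' := 0) (by simp) (by simp) (by simp) (by simp) (by simp) (by simp) (by simp)
    (by simp) (by simp) (by simp) (by simp) (by simp) (by simp) (by simp) (by simp)
  obtain ⟨f₂, hf₂, e₂⟩ := isLayer_regs (d := 1) (z₁ := 1) (z₂ := 0) (z₃ := 0) (y₁ := 0) (y₂ := 0)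
    (y₃ := 0) (y₄ := 0) (s₁ := 1) (s₂ := 0) (s₃ := 0) (r := 1) (t := 0) (t' := 0)
    (u := 0) (u' := 0) (by simp) (by simp) (by simp) (by simp) (by simp) (by simp) (by simp)
    (by simp) (by simp) (by simp) (by simp) (by simp) (by simp) (by simp) (by simp)
  refine ⟨f₂ ∘ f₁ ∘ f₀, (hf₀.trans (Runs.single hf₁)).trans (Runs.single hf₂), ?_⟩
  intro z σ p m hz hz1 hσ hp hm hav
  have hfl : (0 : ℝ) ≤ ⌊2 * z⌋ := by
    exact_mod_cast Int.floor_nonneg.2 (by linarith)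
  simp only [Function.comp_apply, e₀ (fun _ => z) σ p m (fun _ => hz) (fun _ => hz1) hσ hp hm
    (fun _ => hav), e₁, e₂]
  simp only [Pi.zero_apply, one_mul, zero_mul, mul_zero, add_zero, Finset.sum_const_zero,
    relu_of_nonneg hp, relu_of_nonneg hm, zero_add, relu_shift_eq_fract,
    relu_of_nonneg (Int.fract_nonneg _), relu_of_nonneg le_rfl, Fin.sum_univ_one, neg_mul]
  rw [show -(1 - (⌊2 * z⌋ : ℝ)) + 1 = ⌊2 * z⌋ by ring, relu_of_nonneg hfl, relu_of_nonneg hfl]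
  rfl

/-- The first `l` digits of every `z j` are removed and, if the gate `σ` is open, the integer that
they represent is added with weight `v j` to the accumulator. -/
lemma exists_runs_addDigits (d s l : ℕ) (v : Fin d → ℝ) (hv : ∀ j, |v j| * 2 ^ l ≤ 4) :
    ∃ f : (Reg d → ℝ) → (Reg d → ℝ), Runs (l * (s + 4)) f ∧
      ∀ z σ p m, (∀ j, 0 ≤ z j) → (∀ j, z j < 1) → (σ = 0 ∨ σ = 1) → 0 ≤ p → 0 ≤ m →
        (∀ j, RampAvoiding s l (z j)) →
        ∃ p' m', 0 ≤ p' ∧ 0 ≤ m' ∧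
          f (regs z 0 σ p m) = regs (fun j => Int.fract (2 ^ l * z j)) 0 σ p' m' ∧
          p' - m' = p - m + σ * ∑ j, v j * ⌊2 ^ l * z j⌋ := by
  induction l with
  | zero =>
    refine ⟨id, by simpa using Runs.refl, fun z σ p m hz hz1 _ hp hm _ => ⟨p, m, hp, hm, ?_, ?_⟩⟩
    · simp [Int.fract_eq_self.2 ⟨hz _, hz1 _⟩]
    · have : ∀ j, ⌊z j⌋ = 0 := fun j => Int.floor_eq_zero_iff.2 ⟨hz j, hz1 j⟩
      simp [this]
  | succ l ih =>
    obtain ⟨f, hf, e⟩ := ih fun j => by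
      have h := hv j
      rw [pow_succ] at h
      have : 0 ≤ |v j| * 2 ^ l := by positivity
      linarith
    obtain ⟨g, hg, e'⟩ := exists_runs_addDigit d s (fun j => v j * 2 ^ l) fun j => by
      have h := hv j
      rw [pow_succ] at h
      rw [abs_mul, abs_of_nonneg (by positivity : (0 : ℝ) ≤ 2 ^ l)]
      linarith
    refine ⟨f ∘ g, ?_, ?_⟩
    · have := hg.trans hf
      rwa [show s + 4 + l * (s + 4) = (l + 1) * (s + 4) by ring] at this
    · intro z σ p m hz hz1 hσ hp hm hav
      obtain ⟨p₁, m₁, hp₁, hm₁, h₁, h₁'⟩ :=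
        e' z σ p m hz hz1 hσ hp hm fun j => (hav j).notMem (hz j) (hz1 j)
      obtain ⟨p₂, m₂, hp₂, hm₂, h₂, h₂'⟩ := e (fun j => Int.fract (2 * z j)) σ p₁ m₁
        (fun j => Int.fract_nonneg _) (fun j => Int.fract_lt_one _) hσ hp₁ hm₁
        fun j => (hav j).fract_two_mul
      refine ⟨p₂, m₂, hp₂, hm₂, ?_, ?_⟩
      · rw [Function.comp_apply, h₁, h₂]
        simp only [fract_two_pow_mul_fract, pow_succ, mul_assoc]
      · rw [h₂', h₁', add_assoc, ← mul_add, ← Finset.sum_add_distrib]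
        congr 2
        refine Finset.sum_congr rfl fun j _ => ?_
        rw [floor_two_pow_succ_mul]
        ring

/-! ### Packing signed integers into one real number -/

/-- The number in `[0, 1)` whose consecutive blocks of `c` binary digits are the integers `t i`. -/
noncomputable def pack (c : ℕ) {m : ℕ} (t : Fin m → ℝ) : ℝ :=
  ∑ i, t i / 2 ^ (c * (i.val + 1))

lemma pack_succ (c : ℕ) {m : ℕ} (t : Fin (m + 1) → ℝ) :
    pack c t * 2 ^ c = t 0 + pack c (fun i => t i.succ) := by
  have h : (2 : ℝ) ^ c ≠ 0 := by positivity
  rw [pack, Fin.sum_univ_succ, add_mul, Finset.sum_mul, pack]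
  congr 1
  · simp [h]
  · refine Finset.sum_congr rfl fun i _ => ?_
    rw [Fin.val_succ, mul_add c (i.val + 1), pow_add, mul_one]
    field_simp

lemma pack_mem_Ico (c : ℕ) {m : ℕ} (t : Fin m → ℝ) (h0 : ∀ i, 0 ≤ t i)
    (h1 : ∀ i, t i ≤ 2 ^ c - 1) : pack c t ∈ Set.Ico (0 : ℝ) 1 := by
  induction m with
  | zero => simp [pack]
  | succ m ih =>
    obtain ⟨h2, h3⟩ := ih (fun i => t i.succ) (fun i => h0 _) (fun i => h1 _)
    have h4 := pack_succ c t
    have h5 : (0 : ℝ) < 2 ^ c := by positivity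
    constructor
    · exact nonneg_of_mul_nonneg_left (by rw [h4]; linarith [h0 0]) h5
    · have h6 : pack c t * 2 ^ c < 1 * 2 ^ c := by rw [h4]; linarith [h1 0]
      exact lt_of_mul_lt_mul_right h6 h5.le

lemma pack_dyadic (c : ℕ) {m s : ℕ} (hs : c * m ≤ s) (t : Fin m → ℤ) :
    ∃ K : ℤ, pack c (fun i => (t i : ℝ)) * 2 ^ s = K := by
  refine ⟨∑ i, t i * 2 ^ (s - c * (i.val + 1)), ?_⟩
  rw [pack, Finset.sum_mul]
  push_cast
  refine Finset.sum_congr rfl fun i _ => ?_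
  have h : c * (i.val + 1) ≤ s := (Nat.mul_le_mul_left c i.isLt).trans hs
  rw [pow_sub₀ _ (by norm_num) h, div_mul_eq_mul_div, mul_div_assoc, div_eq_mul_inv]

lemma floor_add_div_two_pow {a : ℤ} (ha : 0 ≤ a) {ζ : ℝ} (h0 : 0 ≤ ζ) (h1 : ζ < 1) (q : ℕ) :
    ⌊((a : ℝ) + ζ) / 2 ^ q⌋ = ((a.toNat / 2 ^ q : ℕ) : ℤ) := by
  lift a to ℕ using ha
  have h2 : ⌊(a : ℝ) + ζ⌋₊ = a := by
    rw [Nat.floor_eq_iff (by positivity)]; constructor <;> linarith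
  have h3 := Nat.floor_div_natCast ((a : ℝ) + ζ) (2 ^ q)
  rw [h2] at h3
  push_cast at h3
  rw [Int.toNat_natCast, ← h3, Int.natCast_floor_eq_floor (by positivity)]
  simp

/-- The first block of `1 + g + κ + q` digits of `z` represents a signed integer `a`, shifted by
`2 ^ (g + κ + q)` so that the leading digit tells its sign. The block is removed and the integer
part of `max a 0 / 2 ^ q` is added with weight `v` to the accumulator. -/
lemma exists_runs_addBlock (g κ q s : ℕ) (hs : 0 < s) (v : ℝ) (hv : |v| * 2 ^ κ ≤ 4) :
    ∃ f : (Reg 1 → ℝ) → (Reg 1 → ℝ), Runs ((1 + g + κ + q) * (s + 4)) f ∧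
      ∀ (z ζ σ p m : ℝ) (a K : ℤ), z * 2 ^ s = K → 0 ≤ ζ → ζ < 1 → 0 ≤ σ → 0 ≤ p → 0 ≤ m →
        -2 ^ (g + κ + q) ≤ a → a < 2 ^ (κ + q) →
        z * 2 ^ (1 + g + κ + q) = (a + 2 ^ (g + κ + q) : ℝ) + ζ →
        ∃ σ' p' m', 0 ≤ σ' ∧ 0 ≤ p' ∧ 0 ≤ m' ∧
          f (regs (fun _ => z) 0 σ p m) = regs (fun _ => ζ) 0 σ' p' m' ∧
          p' - m' = p - m + v * (a.toNat / 2 ^ q : ℕ) := by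
  obtain ⟨f₁, hf₁, e₁⟩ := exists_runs_setGate s
  obtain ⟨f₂, hf₂, e₂⟩ := exists_runs_addDigits 1 s g (fun _ => 0) (by simp)
  obtain ⟨f₃, hf₃, e₃⟩ := exists_runs_addDigits 1 s κ (fun _ => v) (fun _ => hv)
  obtain ⟨f₄, hf₄, e₄⟩ := exists_runs_addDigits 1 s q (fun _ => 0) (by simp)
  refine ⟨f₄ ∘ f₃ ∘ f₂ ∘ f₁, ?_, ?_⟩
  · have := ((hf₁.trans hf₂).trans hf₃).trans hf₄
    rwa [show s + 4 + g * (s + 4) + κ * (s + 4) + q * (s + 4) = (1 + g + κ + q) * (s + 4) by ring]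
      at this
  intro z ζ σ p m a K hK hζ0 hζ1 hσ hp hm ha0 ha1 hz
  have ha0' : -2 ^ (g + κ + q) ≤ (a : ℝ) := by exact_mod_cast ha0
  have ha1' : (a : ℝ) + 1 ≤ 2 ^ (κ + q) := by exact_mod_cast ha1
  have hM : (0 : ℝ) < 2 ^ (g + κ + q) := by positivity
  have hle : (2 : ℝ) ^ (κ + q) ≤ 2 ^ (g + κ + q) :=
    pow_le_pow_right₀ (by norm_num) (by omega)
  have hz2 : z * 2 * 2 ^ (g + κ + q) = (a + 2 ^ (g + κ + q) : ℝ) + ζ := by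
    rw [← hz]; ring
  have hz0 : 0 ≤ z := by
    have : 0 ≤ z * (2 * 2 ^ (g + κ + q)) := by nlinarith
    exact nonneg_of_mul_nonneg_left this (by positivity)
  have hz1 : z < 1 := by
    have : z * (2 * 2 ^ (g + κ + q)) < 1 * (2 * 2 ^ (g + κ + q)) := by nlinarith
    exact lt_of_mul_lt_mul_right this (by positivity)
  set b := ⌊2 * z⌋ with hb
  have hb01 : (b : ℝ) = 0 ∨ (b : ℝ) = 1 := by
    rcases floor_two_mul_eq_zero_or_one hz0 hz1 with h | h <;> simp [hb, h]
  have hb0 : (0 : ℝ) ≤ b := by rcases hb01 with h | h <;> simp [h]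
  have h₁ := e₁ z σ p m hz0 hz1 hσ hp hm
    ((rampAvoiding_of_dyadic 1 hs hK).notMem hz0 hz1)
  have key : ∀ t : ℕ, ∃ k : ℤ, Int.fract (2 ^ t * z) * 2 ^ s = k := fun t =>
    exists_fract_mul_two_pow_eq t hK
  have av : ∀ t l : ℕ, RampAvoiding s l (Int.fract (2 ^ t * z)) := fun t l =>
    rampAvoiding_of_dyadic l hs (key t).choose_spec
  have nest : ∀ l t : ℕ, Int.fract (2 ^ l * Int.fract (2 ^ t * z)) =
      Int.fract (2 ^ (t + l) * z) := fun l t => by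
    rw [fract_two_pow_mul_fract, ← mul_assoc, ← pow_add, add_comm]
  obtain ⟨p₂, m₂, hp₂, hm₂, h₂, h₂'⟩ := e₂ (fun _ => Int.fract (2 ^ 1 * z)) b p m
    (fun _ => Int.fract_nonneg _) (fun _ => Int.fract_lt_one _) hb01 hp hm (fun _ => av 1 g)
  simp only [nest] at h₂ h₂'
  obtain ⟨p₃, m₃, hp₃, hm₃, h₃, h₃'⟩ := e₃ (fun _ => Int.fract (2 ^ (1 + g) * z)) b p₂ m₂
    (fun _ => Int.fract_nonneg _) (fun _ => Int.fract_lt_one _) hb01 hp₂ hm₂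
    (fun _ => av (1 + g) κ)
  simp only [nest] at h₃
  obtain ⟨p₄, m₄, hp₄, hm₄, h₄, h₄'⟩ := e₄ (fun _ => Int.fract (2 ^ (1 + g + κ) * z)) b p₃ m₃
    (fun _ => Int.fract_nonneg _) (fun _ => Int.fract_lt_one _) hb01 hp₃ hm₃
    (fun _ => av (1 + g + κ) q)
  simp only [nest] at h₄
  refine ⟨b, p₄, m₄, hb0, hp₄, hm₄, ?_, ?_⟩
  · rw [pow_one] at h₂
    simp only [Function.comp_apply]
    rw [h₁, ← hb, h₂, h₃, h₄]
    have : Int.fract (2 ^ (1 + g + κ + q) * z) = ζ := by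
      rw [mul_comm, hz, show ((a : ℝ) + 2 ^ (g + κ + q)) + ζ =
        ζ + ((a + 2 ^ (g + κ + q) : ℤ) : ℝ) by push_cast; ring, Int.fract_add_intCast]
      exact Int.fract_eq_self.2 ⟨hζ0, hζ1⟩
    rw [this]
  · rw [h₄', h₃', h₂']
    simp only [zero_mul, Finset.sum_const_zero, mul_zero, add_zero, Fin.sum_univ_one]
    congr 1
    by_cases ha : 0 ≤ a
    · have ha' : (0 : ℝ) ≤ a := by exact_mod_cast ha
      have hb1 : b = 1 := by
        rw [hb, Int.floor_eq_iff]
        push_cast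
        constructor
        · have : 1 * 2 ^ (g + κ + q) ≤ 2 * z * 2 ^ (g + κ + q) := by linarith
          exact le_of_mul_le_mul_right this hM
        · linarith
      have hfr : Int.fract (2 ^ (1 + g) * z) = ((a : ℝ) + ζ) / 2 ^ (κ + q) := by
        have : 2 ^ (1 + g) * z = ((a : ℝ) + ζ) / 2 ^ (κ + q) + ((2 ^ g : ℤ) : ℝ) := by
          rw [div_add' _ _ _ (by positivity), eq_div_iff (by positivity)]
          push_cast
          have e1 : 2 ^ (1 + g) * z * 2 ^ (κ + q) = z * 2 ^ (1 + g + κ + q) := by ring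
          have e2 : (2 : ℝ) ^ g * 2 ^ (κ + q) = 2 ^ (g + κ + q) := by ring
          rw [e1, hz, e2]
          ring
        rw [this, Int.fract_add_intCast, Int.fract_eq_self]
        constructor
        · positivity
        · rw [div_lt_one (by positivity)]; linarith
      rw [hfr, hb1, show 2 ^ κ * (((a : ℝ) + ζ) / 2 ^ (κ + q)) = ((a : ℝ) + ζ) / 2 ^ q by
        rw [pow_add]; field_simp, floor_add_div_two_pow ha hζ0 hζ1,
        Int.cast_one, one_mul, Int.cast_natCast]
    · have hb1 : b = 0 := by
        have : (a : ℝ) + 1 ≤ 0 := by exact_mod_cast (by omega : a + 1 ≤ 0)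
        rw [hb, Int.floor_eq_iff]
        push_cast
        refine ⟨by linarith, ?_⟩
        have : 2 * z * 2 ^ (g + κ + q) < 1 * 2 ^ (g + κ + q) := by linarith
        linarith [lt_of_mul_lt_mul_right this hM.le]
      rw [hb1, Int.toNat_of_nonpos (by omega)]
      simp

/-- All blocks of a packed vector are read in turn. -/
lemma exists_runs_addBlocks (g κ q s : ℕ) (hs : 0 < s) {w : ℕ} (v : Fin w → ℝ)
    (hv : ∀ i, |v i| * 2 ^ κ ≤ 4) (hw : (1 + g + κ + q) * w ≤ s) :
    ∃ f : (Reg 1 → ℝ) → (Reg 1 → ℝ), Runs (w * ((1 + g + κ + q) * (s + 4))) f ∧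
      ∀ (σ p m : ℝ) (a : Fin w → ℤ), 0 ≤ σ → 0 ≤ p → 0 ≤ m →
        (∀ i, -2 ^ (g + κ + q) ≤ a i) → (∀ i, a i < 2 ^ (κ + q)) →
        ∃ z' σ' p' m', 0 ≤ p' ∧ 0 ≤ m' ∧
          f (regs (fun _ => pack (1 + g + κ + q) fun i => (a i + 2 ^ (g + κ + q) : ℝ)) 0 σ p m) =
            regs (fun _ => z') 0 σ' p' m' ∧
          p' - m' = p - m + ∑ i, ((a i).toNat / 2 ^ q : ℕ) * v i := by
  induction w with
  | zero =>
    exact ⟨id, by simpa using Runs.refl,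
      fun σ p m a _ hp hm _ _ => ⟨_, σ, p, m, hp, hm, rfl, by simp⟩⟩
  | succ w ih =>
    obtain ⟨f, hf, e⟩ := exists_runs_addBlock g κ q s hs (v 0) (hv 0)
    obtain ⟨f', hf', e'⟩ := ih (fun i => v i.succ) (fun i => hv _)
      ((Nat.mul_le_mul_left _ (Nat.le_succ w)).trans hw)
    refine ⟨f' ∘ f, ?_, ?_⟩
    · have := hf.trans hf'
      rwa [show (1 + g + κ + q) * (s + 4) + w * ((1 + g + κ + q) * (s + 4)) =
        (w + 1) * ((1 + g + κ + q) * (s + 4)) by ring] at this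
    intro σ p m a hσ hp hm ha0 ha1
    obtain ⟨K, hK⟩ := pack_dyadic (1 + g + κ + q) hw fun i => a i + 2 ^ (g + κ + q)
    push_cast at hK
    have hle : (2 : ℝ) ^ (κ + q) ≤ 2 ^ (g + κ + q) :=
      pow_le_pow_right₀ (by norm_num) (by omega)
    have htail := pack_mem_Ico (1 + g + κ + q)
      (fun i : Fin w => (a i.succ + 2 ^ (g + κ + q) : ℝ))
      (fun i => by
        have : -2 ^ (g + κ + q) ≤ (a i.succ : ℝ) := by exact_mod_cast ha0 i.succ
        linarith)
      (fun i => by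
        have : (a i.succ : ℝ) + 1 ≤ 2 ^ (κ + q) := by exact_mod_cast ha1 i.succ
        have h2 : (2 : ℝ) ^ (1 + g + κ + q) = 2 * 2 ^ (g + κ + q) := by ring
        linarith)
    obtain ⟨σ₁, p₁, m₁, hσ₁, hp₁, hm₁, h₁, h₁'⟩ := e _ _ σ p m (a 0) K hK htail.1 htail.2 hσ hp hm
      (ha0 0) (ha1 0) (pack_succ _ _)
    obtain ⟨z₂, σ₂, p₂, m₂, hp₂, hm₂, h₂, h₂'⟩ := e' σ₁ p₁ m₁ (fun i => a i.succ) hσ₁ hp₁ hm₁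
      (fun i => ha0 _) (fun i => ha1 _)
    refine ⟨z₂, σ₂, p₂, m₂, hp₂, hm₂, by rw [Function.comp_apply, h₁, h₂], ?_⟩
    rw [h₂', h₁', Fin.sum_univ_succ]
    ring

/-! ### Rounding one affine map with rectifier -/

/-- If the inputs `x j` of a neuron are known up to `X / 2 ^ q` as dyadic numbers `k j / 2 ^ q`, then
integer arithmetic with weights rounded to multiples of `2 ^ (-q)`, the bias rounded to a multiple
of `2 ^ (-2 * q)` and the result truncated to a multiple of `2 ^ (-q)` gives its output up to
`G * X / 2 ^ q`. -/
lemma round_neuron {m n : ℕ} {B G X : ℝ} (hmn : m ≤ n) (hn0 : 0 < n) (hB : 1 ≤ B)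
    (hG : 5 * n * B ≤ G) (hX : 1 ≤ X) (q : ℕ) (w : Fin m → ℝ) (b : ℝ) (hw : ∀ j, |w j| ≤ B)
    (hb : |b| ≤ B) (x : Fin m → ℝ) (k : Fin m → ℕ) (hx0 : ∀ j, 0 ≤ x j) (hx : ∀ j, x j ≤ X)
    (hk : ∀ j, |(k j : ℝ) - 2 ^ q * x j| ≤ X) (a : ℤ)
    (ha : a = ∑ j, ⌊2 ^ q * w j⌋ * k j + ⌊2 ^ (2 * q) * b⌋) :
    relu (∑ j, w j * x j + b) ≤ G * X ∧
      |((a.toNat / 2 ^ q : ℕ) : ℝ) - 2 ^ q * relu (∑ j, w j * x j + b)| ≤ G * X ∧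
      |(a : ℝ)| < 2 ^ (2 * q) * (2 * (G * X)) := by
  set P := ∑ j, w j * x j + b with hP
  set Q : ℝ := 2 ^ q with hQ
  have hQ2 : (2 : ℝ) ^ (2 * q) = Q * Q := by rw [hQ]; ring
  have hQ1 : 1 ≤ Q := one_le_pow₀ (by norm_num)
  have hn : (m : ℝ) ≤ n := by exact_mod_cast hmn
  have hn1 : (1 : ℝ) ≤ n := by exact_mod_cast hn0
  have hPle : |P| ≤ n * B * X + B := by
    calc |P| ≤ ∑ j, |w j * x j| + |b| :=
          (abs_add_le _ _).trans (add_le_add_left (Finset.abs_sum_le_sum_abs _ _) _)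
      _ ≤ ∑ _j : Fin m, B * X + B := by
          refine add_le_add (Finset.sum_le_sum fun j _ => ?_) hb
          rw [abs_mul, abs_of_nonneg (hx0 j)]
          exact mul_le_mul (hw j) (hx j) (hx0 j) (by linarith)
      _ ≤ n * B * X + B := by
          rw [Finset.sum_const, Finset.card_univ, Fintype.card_fin, nsmul_eq_mul, ← mul_assoc]
          gcongr
  have hfl : ∀ y : ℝ, |(⌊y⌋ : ℝ) - y| ≤ 1 := fun y => by
    rw [abs_le]; constructor <;> linarith [Int.floor_le y, Int.lt_floor_add_one y]
  have hdiff : |(a : ℝ) - Q * Q * P| ≤ Q * (X * (2 * n + n * B + 1)) := by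
    have e : (a : ℝ) - Q * Q * P =
        ∑ j, (((⌊Q * w j⌋ : ℝ) - Q * w j) * k j + Q * w j * (k j - Q * x j)) +
          ((⌊Q * Q * b⌋ : ℝ) - Q * Q * b) := by
      rw [ha, hP, hQ2]
      push_cast
      rw [mul_add, Finset.mul_sum, add_sub_add_comm, ← Finset.sum_sub_distrib]
      congr 1
      refine Finset.sum_congr rfl fun j _ => ?_
      ring
    rw [e]
    calc _ ≤ ∑ j : Fin m, |((⌊Q * w j⌋ : ℝ) - Q * w j) * k j + Q * w j * (k j - Q * x j)| + 1 :=
          (abs_add_le _ _).trans (add_le_add (Finset.abs_sum_le_sum_abs _ _) (hfl _))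
      _ ≤ ∑ _j : Fin m, (2 * (Q * X) + Q * B * X) + 1 := by
          gcongr with j
          refine (abs_add_le _ _).trans (add_le_add ?_ ?_)
          · rw [abs_mul, Nat.abs_cast]
            have h1 : (k j : ℝ) ≤ 2 * (Q * X) := by
              have h2 := (abs_le.1 (hk j)).2
              have h3 : Q * x j ≤ Q * X := by gcongr; exact hx j
              nlinarith
            calc _ ≤ 1 * (k j : ℝ) := by gcongr; exact hfl _
              _ ≤ _ := by linarith
          · rw [abs_mul, abs_mul, abs_of_nonneg (by linarith : 0 ≤ Q)]
            gcongr
            · exact hw j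
            · exact hk j
      _ ≤ n * (2 * (Q * X) + Q * B * X) + Q * X := by
          rw [Finset.sum_const, Finset.card_univ, Fintype.card_fin, nsmul_eq_mul]
          have h1 : 1 ≤ Q * X := by nlinarith
          have h2 : 0 ≤ 2 * (Q * X) + Q * B * X := by positivity
          have := mul_le_mul_of_nonneg_right hn h2
          linarith
      _ = _ := by ring
  have hnB : (n : ℝ) ≤ n * B := by nlinarith
  have hnB1 : B ≤ n * B := by nlinarith
  have hG' : X * (5 * n * B) ≤ G * X := by rw [mul_comm]; gcongr
  refine ⟨?_, ?_, ?_⟩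
  · have h1 : relu P ≤ |P| := max_le (abs_nonneg _) (le_abs_self _)
    nlinarith
  · have h1 : |(a.toNat : ℝ) - Q * Q * relu P| ≤ Q * (X * (2 * n + n * B + 1)) := by
      have h2 : (a.toNat : ℝ) = relu a := by
        rw [relu, max_comm]
        exact_mod_cast Int.toNat_eq_max a
      have h3 : Q * Q * relu P = relu (Q * Q * P) := by
        rw [relu, relu, mul_max_of_nonneg _ _ (by positivity), mul_zero]
      rw [h2, h3]
      exact (abs_relu_sub_relu_le _ _).trans hdiff
    have h2 : |((a.toNat / 2 ^ q : ℕ) : ℝ) - (a.toNat : ℝ) / Q| ≤ 1 := by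
      have h3 := Nat.floor_div_natCast (a.toNat : ℝ) (2 ^ q)
      rw [Nat.floor_natCast] at h3
      push_cast at h3
      rw [← h3, abs_le]
      have h4 : (0 : ℝ) ≤ a.toNat / 2 ^ q := by positivity
      constructor <;> linarith [Nat.floor_le h4, Nat.lt_floor_add_one ((a.toNat : ℝ) / 2 ^ q)]
    have h3 : |(a.toNat : ℝ) / Q - Q * relu P| ≤ X * (2 * n + n * B + 1) := by
      have e : (a.toNat : ℝ) / Q - Q * relu P = ((a.toNat : ℝ) - Q * Q * relu P) / Q := by
        field_simp
      rw [e, abs_div, abs_of_pos (by linarith : 0 < Q), div_le_iff₀ (by linarith)]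
      linarith
    have h4 := abs_sub_le ((a.toNat / 2 ^ q : ℕ) : ℝ) ((a.toNat : ℝ) / Q) (Q * relu P)
    have h5 : X * (2 * n + n * B + 1) + 1 ≤ X * (5 * n * B) := by nlinarith
    linarith
  · have h1 : |(a : ℝ)| ≤ Q * Q * (n * B * X + B) + Q * (X * (2 * n + n * B + 1)) := by
      have h2 : (a : ℝ) = Q * Q * P + ((a : ℝ) - Q * Q * P) := by ring
      rw [h2]
      refine (abs_add_le _ _).trans (add_le_add ?_ hdiff)
      rw [abs_mul, abs_of_nonneg (by positivity)]
      gcongr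
    have h2 : Q * (X * (2 * n + n * B + 1)) ≤ Q * Q * (X * (2 * n + n * B + 1)) := by
      gcongr
      nlinarith
    have h3 : n * B * X + B + X * (2 * n + n * B + 1) < 2 * (X * (5 * n * B)) := by nlinarith
    rw [hQ2]
    calc |(a : ℝ)| ≤ Q * Q * (n * B * X + B + X * (2 * n + n * B + 1)) := by linarith
      _ < Q * Q * (2 * (X * (5 * n * B))) := by gcongr
      _ ≤ Q * Q * (2 * (G * X)) := by gcongr

/-! ### Simulating a network on packed preactivations -/

/-- The accumulator, plus a constant, becomes the new fraction to be read. -/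
lemma exists_isLayer_load (c : ℝ) (hc : |c| ≤ 2) :
    ∃ f : (Reg 1 → ℝ) → (Reg 1 → ℝ), IsLayer f ∧ ∀ z σ p m,
      f (regs z 0 σ p m) = regs (fun _ => relu (p - m + c)) 0 0 0 0 := by
  let W : Reg 1 → Reg 1 → ℝ := Sum.elim (fun _ => Sum.elim 0 (Sum.elim 0 ![0, 1, -1])) 0
  let b : Reg 1 → ℝ := Sum.elim (fun _ => c) 0
  refine ⟨fun x i => relu (∑ j, W i j * x j + b i), ⟨W, b, ?_, ?_, fun _ _ => rfl⟩, ?_⟩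
  · rintro (i | i) (j | j | j)
    · simp [W]
    · simp [W]
    · fin_cases j <;> simp [W]
    all_goals simp [W]
  · rintro (i | i)
    · simpa [b] using hc
    · simp [b]
  · intro z σ p m
    funext i
    rcases i with (i | i | i)
    · simp [W, b, regs, Fintype.sum_sum_type, Fin.sum_univ_three, sub_eq_add_neg]
    · simp [W, b, regs, relu]
    · fin_cases i <;> simp [W, b, regs, relu]

/-- The accumulator is handed over from a machine with `d` fractions to one with a single
fraction. -/
lemma exists_isLayer_handOver (d : ℕ) :
    ∃ f : (Reg d → ℝ) → (Reg 1 → ℝ), IsLayer f ∧ ∀ z y σ p m, 0 ≤ p → 0 ≤ m →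
      f (regs z y σ p m) = regs 0 0 0 p m := by
  let W : Reg 1 → Reg d → ℝ := Sum.elim 0 (Sum.elim 0
    ![0, Sum.elim 0 (Sum.elim 0 ![0, 1, 0]), Sum.elim 0 (Sum.elim 0 ![0, 0, 1])])
  refine ⟨fun x i => relu (∑ j, W i j * x j + 0), ⟨W, 0, ?_, by simp, fun _ _ => rfl⟩, ?_⟩
  · rintro (i | i | i) (j | j | j)
    iterate 6 simp [W]
    · fin_cases i <;> simp [W]
    · fin_cases i <;> simp [W]
    · fin_cases i <;> fin_cases j <;> simp [W]
  · intro z y σ p m hp hm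
    funext i
    rcases i with (i | i | i)
    · simp [W, regs, relu]
    · simp [W, regs, relu]
    · fin_cases i <;> simp [W, regs, Fintype.sum_sum_type, Fin.sum_univ_three, relu, hp, hm]

/-- The first layer rescales the inputs and opens the gate. -/
lemma exists_isLayer_input (d : ℕ) (α β : ℝ) (hα : |α| ≤ 2) (hβ : |β| ≤ 2) :
    ∃ f : (Fin d → ℝ) → (Reg d → ℝ), IsLayer f ∧ ∀ x,
      f x = regs (fun j => relu (α * x j + β)) 0 1 0 0 := by
  classical
  let W : Reg d → Fin d → ℝ := Sum.elim (fun i => Pi.single i α) 0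
  let b : Reg d → ℝ := Sum.elim (fun _ => β) (Sum.elim 0 ![1, 0, 0])
  refine ⟨fun x i => relu (∑ j, W i j * x j + b i), ⟨W, b, ?_, ?_, fun _ _ => rfl⟩, ?_⟩
  · rintro (i | i) j
    · by_cases h : j = i
      · subst h; simpa [W] using hα
      · simp [W, h]
    · simp [W]
  · rintro (i | i | i)
    · simpa [b] using hβ
    · simp [b]
    · fin_cases i <;> simp [b]
  · intro x
    funext i
    rcases i with (i | i | i)
    · simp [W, b, regs, Pi.single_apply, ite_mul]
    · simp [W, b, regs, relu]
    · fin_cases i <;> simp [W, b, regs, relu]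

/-- The output layer of the simulated network. The weights are scaled down by `2 ^ (-κ)` while the
accumulator is filled, and `κ` doublings restore the scale. -/
lemma exists_realizes_output (κ q : ℕ) {m : ℕ} {B : ℝ} (w : Fin m → ℝ) (b : ℝ) (hB : B ≤ 2 ^ q)
    (hw : ∀ j, |w j| ≤ B) (hb : |b| ≤ B) (hqκ : q ≤ κ) :
    ∃ v : Fin m → ℝ, (∀ j, |v j| * 2 ^ κ ≤ 1) ∧ ∃ F,
      Realizes (regEquiv 1) 5 (κ + 2) (30 * (κ + 2)) F ∧
      ∀ (k : Fin m → ℕ) z σ p n, 0 ≤ p → 0 ≤ n → p - n = ∑ j, k j * v j →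
        F (regs z 0 σ p n) = ∑ j, w j * (k j / 2 ^ q) + b := by
  have hq0 : (0 : ℝ) < 2 ^ q := by positivity
  have hκ0 : (0 : ℝ) < 2 ^ κ := by positivity
  have hb2 : |b| / 2 ^ κ ≤ 1 := by
    rw [div_le_one hκ0]
    exact (hb.trans hB).trans (pow_le_pow_right₀ (by norm_num) hqκ)
  have hmax : ∀ y : ℝ, |y| ≤ |b| → |max (y / 2 ^ κ) 0| ≤ 2 := fun y hy => by
    rw [abs_of_nonneg (le_max_right _ _)]
    refine max_le ?_ (by norm_num)
    have : y / 2 ^ κ ≤ |b| / 2 ^ κ := by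
      gcongr; exact (le_abs_self y).trans hy
    linarith
  obtain ⟨f₁, hf₁, e₁⟩ := isLayer_regs (d := 1) (z₁ := 0) (z₂ := 0) (z₃ := 0) (y₁ := 0) (y₂ := 0)
    (y₃ := 0) (y₄ := 0) (s₁ := 0) (s₂ := 0) (s₃ := 0) (r := 1) (t := max (b / 2 ^ κ) 0)
    (t' := max (-b / 2 ^ κ) 0) (u := 0) (u' := 0) (by simp) (by simp) (by simp) (by simp) (by simp)
    (by simp) (by simp) (by simp) (by simp) (by simp) (by simp) (hmax b le_rfl)
    (hmax (-b) (abs_neg b).le) (by simp) (by simp)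
  obtain ⟨f₂, hf₂, e₂⟩ := isLayer_regs (d := 1) (z₁ := 0) (z₂ := 0) (z₃ := 0) (y₁ := 0) (y₂ := 0)
    (y₃ := 0) (y₄ := 0) (s₁ := 0) (s₂ := 0) (s₃ := 0) (r := 2) (t := 0)
    (t' := 0) (u := 0) (u' := 0) (by simp) (by simp) (by simp) (by simp) (by simp)
    (by simp) (by simp) (by simp) (by simp) (by simp) (by simp) (by simp)
    (by simp) (by simp) (by simp)
  let w' : Reg 1 → ℝ := Sum.elim 0 (Sum.elim 0 ![0, 1, -1])
  have hout : Realizes (regEquiv 1) 5 1 6 (fun x => ∑ i, w' i * x i) := by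
    have hw' : ∀ i, |w' i| ≤ 2 := by
      rintro (i | i | i)
      · simp [w']
      · simp [w']
      · fin_cases i <;> simp [w']
    refine ⟨.output (fun j => w' ((regEquiv 1).symm j)) 0, le_rfl, ⟨fun j => hw' _, by simp⟩,
      le_rfl, le_rfl, fun x => ?_⟩
    rw [ReLUNet.eval, add_zero]
    exact Equiv.sum_comp (regEquiv 1).symm (fun i => w' i * x i)
  refine ⟨fun j => w j / (2 ^ q * 2 ^ κ), fun j => ?_, _,
    ((hout.runs (Runs.iterate hf₂ κ) (by norm_num) (by norm_num)).runs (Runs.single hf₁)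
      (by norm_num) (by norm_num)).mono le_rfl (by omega) (by omega), ?_⟩
  · rw [abs_div, abs_of_pos (by positivity : (0 : ℝ) < 2 ^ q * 2 ^ κ), ← div_div,
      div_mul_cancel₀ _ hκ0.ne', div_le_one hq0]
    exact (hw j).trans hB
  · intro k z σ p n hp hn hpn
    have hp1 : 0 ≤ p + max (b / 2 ^ κ) 0 := add_nonneg hp (le_max_right _ _)
    have hn1 : 0 ≤ n + max (-b / 2 ^ κ) 0 := add_nonneg hn (le_max_right _ _)
    have hit : ∀ l : ℕ, f₂^[l] (f₁ (regs z 0 σ p n)) =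
        regs 0 0 0 (2 ^ l * (p + max (b / 2 ^ κ) 0)) (2 ^ l * (n + max (-b / 2 ^ κ) 0)) := by
      intro l
      induction l with
      | zero =>
        simp only [Function.iterate_zero, id, e₁]
        simp [relu_of_nonneg hp1, relu_of_nonneg hn1, relu_of_nonneg le_rfl]
        rfl
      | succ l ih =>
        rw [Function.iterate_succ_apply', ih, e₂]
        simp only [Pi.zero_apply, mul_zero, add_zero, Finset.sum_const_zero,
          relu_of_nonneg le_rfl]
        rw [relu_of_nonneg (by positivity), relu_of_nonneg (by positivity), pow_succ', mul_assoc,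
          mul_assoc]
        rfl
    have hbb : max (b / 2 ^ κ) 0 - max (-b / 2 ^ κ) 0 = b / 2 ^ κ := by
      rw [neg_div]
      rcases le_total (b / 2 ^ κ) 0 with h | h <;> simp [h]
    simp only [Function.comp_apply, hit]
    have : 2 ^ κ * (p + max (b / 2 ^ κ) 0) - 2 ^ κ * (n + max (-b / 2 ^ κ) 0) =
        ∑ j, w j * (k j / 2 ^ q) + b := by
      rw [← mul_sub, add_sub_add_comm, hpn, hbb, mul_add, mul_div_cancel₀ _ hκ0.ne',
        Finset.mul_sum]
      congr 1
      refine Finset.sum_congr rfl fun j _ => ?_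
      field_simp
    rw [← this]
    simp [w', regs, Fintype.sum_sum_type, Fin.sum_univ_three, sub_eq_add_neg]

/-- Packing is linear: a linear form in `k` whose coefficients are packed columns of a matrix
computes the packed matrix-vector product. -/
lemma sum_mul_pack_add_pack (c : ℕ) {m m' : ℕ} (k : Fin m → ℕ) (w : Fin m' → Fin m → ℝ)
    (β : Fin m' → ℝ) (o : ℝ) :
    ∑ j, k j * pack c (fun l => w l j) + pack c (fun l => β l + o) =
      pack c (fun l => ∑ j, w l j * k j + β l + o) := by
  simp only [pack, Finset.mul_sum]
  rw [Finset.sum_comm, ← Finset.sum_add_distrib]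
  refine Finset.sum_congr rfl fun l _ => ?_
  rw [add_assoc, add_div (∑ j, w l j * (k j : ℝ)), Finset.sum_div]
  congr 1
  refine Finset.sum_congr rfl fun j _ => ?_
  ring

/-- Every network can be simulated on a machine with a single fraction whose accumulator initially
holds a suitable linear form in the integers `k j`, which are the inputs `x j` in units of
`2 ^ (-q)`. The factor `2 ^ g` bounds the growth, per layer, of both the activations and the
errors; `i` counts the layers of an ambient network of depth `D - 1` that precede `N`, plus one.
Then `κ` digits suffice for every activation, and the bound on `v` keeps all weights that occur
while the accumulator is filled within `[-2, 2]`. -/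
lemma exists_realizes_simulation {n g q κ D s : ℕ} {B : ℝ} (hn0 : 0 < n) (hB : 1 ≤ B)
    (hg : 5 * n * B ≤ 2 ^ g) (hq : g * D ≤ q) (hκ : κ = q + g * D + 1) (hD : 0 < D)
    (hs : s = n * (1 + g + κ + q)) {m : ℕ} (N : ReLUNet m) (i : ℕ) (hN : N.width ≤ n)
    (hNB : N.WeightsBoundedBy B) (hi : i + N.depth = D) :
    ∃ v : Fin m → ℝ, (∀ j, |v j| * 2 ^ κ ≤ 1) ∧ ∃ F,
      Realizes (regEquiv 1) 5 (N.depth * (s * (s + 4) + κ + 2))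
        (30 * (N.depth * (s * (s + 4) + κ + 2))) F ∧
      ∀ (x : Fin m → ℝ) (k : Fin m → ℕ), (∀ j, 0 ≤ x j) → (∀ j, x j ≤ 2 ^ (g * i)) →
        (∀ j, |(k j : ℝ) - 2 ^ q * x j| ≤ 2 ^ (g * i)) →
        ∀ z σ p r, 0 ≤ p → 0 ≤ r → p - r = ∑ j, k j * v j →
          |F (regs z 0 σ p r) - N.eval x| ≤ 2 ^ (g * D) / 2 ^ q := by
  have h1g : (1 : ℝ) ≤ 2 ^ g := one_le_pow₀ (by norm_num)
  have hn1 : (1 : ℝ) ≤ n := by exact_mod_cast hn0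
  have hBg : B ≤ 2 ^ g := by nlinarith
  have hnBg : n * B ≤ 2 ^ g := by nlinarith
  have hgq : g ≤ q := (Nat.le_mul_of_pos_right g hD).trans hq
  induction N generalizing i with
  | @output m w b =>
    obtain ⟨v, hv, F, hF, e⟩ := exists_realizes_output κ q w b
      (hBg.trans (pow_le_pow_right₀ (by norm_num) hgq)) hNB.1 hNB.2 (by omega)
    refine ⟨v, hv, F, hF.mono le_rfl ?_ ?_, fun x k hx0 hx hk z σ p r hp hr hpr => ?_⟩
    · simp [ReLUNet.depth]
    · simp [ReLUNet.depth]
    rw [e k z σ p r hp hr hpr, ReLUNet.eval, add_sub_add_right_eq_sub, ← Finset.sum_sub_distrib]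
    have hm : (m : ℝ) ≤ n := by exact_mod_cast hN
    have hQ : (0 : ℝ) < 2 ^ q := by positivity
    have hDi : D = i + 1 := hi.symm
    calc |∑ j, (w j * (k j / 2 ^ q) - w j * x j)|
        ≤ ∑ j, |w j * (k j / 2 ^ q) - w j * x j| := Finset.abs_sum_le_sum_abs _ _
      _ ≤ ∑ _j : Fin m, B * (2 ^ (g * i) / 2 ^ q) := by
          refine Finset.sum_le_sum fun j _ => ?_
          rw [← mul_sub, abs_mul]
          have h : |(k j : ℝ) / 2 ^ q - x j| ≤ 2 ^ (g * i) / 2 ^ q := by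
            have e1 : (k j : ℝ) / 2 ^ q - x j = (k j - 2 ^ q * x j) / 2 ^ q := by field_simp
            rw [e1, abs_div, abs_of_pos hQ]
            gcongr
            exact hk j
          exact mul_le_mul (hNB.1 j) h (abs_nonneg _) (by linarith)
      _ = m * B * 2 ^ (g * i) / 2 ^ q := by
          rw [Finset.sum_const, Finset.card_univ, Fintype.card_fin, nsmul_eq_mul]; ring
      _ ≤ 2 ^ g * 2 ^ (g * i) / 2 ^ q := by
          have : m * B ≤ n * B := by gcongr
          gcongr
          linarith
      _ = 2 ^ (g * D) / 2 ^ q := by rw [hDi, ← pow_add]; ring_nf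
  | @hidden m m' hm' W b N ih =>
    have hmn : m ≤ n := (le_max_left _ _).trans hN
    have hm'n : m' ≤ n := by
      have h1 : m' ≤ N.width := by cases N <;> simp [ReLUNet.width]
      exact h1.trans ((le_max_right _ _).trans hN)
    obtain ⟨hWB, hbB, hNB'⟩ := hNB
    obtain ⟨v, hv, F, hF, e⟩ := ih (i + 1) ((le_max_right _ _).trans hN) hNB' (by
      simp only [ReLUNet.depth] at hi; omega)
    have hs0 : 0 < s := by rw [hs]; positivity
    obtain ⟨f, hf, ef⟩ := exists_runs_addBlocks g κ q s hs0 v (fun j => (hv j).trans (by norm_num))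
      (by rw [hs, mul_comm]; exact Nat.mul_le_mul_right _ hm'n)
    have hoff : (2 : ℝ) ^ (1 + g + κ + q) = 2 * 2 ^ (g + κ + q) := by ring
    have hQ1 : (1 : ℝ) ≤ 2 ^ q := one_le_pow₀ (by norm_num)
    have hQκ : (2 * 2 ^ q : ℝ) ≤ 2 ^ κ := by
      rw [← pow_succ']; exact pow_le_pow_right₀ (by norm_num) (by omega)
    have hfl : ∀ y : ℝ, |(⌊y⌋ : ℝ)| ≤ |y| + 1 := fun y => by
      have := abs_le.1 (le_refl |y|)
      rw [abs_le]; constructor <;> linarith [Int.floor_le y, Int.lt_floor_add_one y]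
    -- The packed biases, with the offset that makes all blocks nonnegative.
    set c : ℝ := pack (1 + g + κ + q)
      fun l => ((⌊2 ^ (2 * q) * b l⌋ : ℤ) + 2 ^ (g + κ + q) : ℝ) with hc
    have hc01 : c ∈ Set.Ico (0 : ℝ) 1 := by
      have hβ : ∀ l, |((⌊2 ^ (2 * q) * b l⌋ : ℤ) : ℝ)| + 1 ≤ 2 ^ (g + κ + q) := fun l => by
        have h1 := hfl (2 ^ (2 * q) * b l)
        rw [abs_mul, abs_of_pos (by positivity : (0 : ℝ) < 2 ^ (2 * q))] at h1
        have h2 : (2 : ℝ) ^ (2 * q) * |b l| ≤ 2 ^ (2 * q) * (2 ^ g - 1) := by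
          have : B ≤ 2 ^ g - 1 := by nlinarith
          gcongr
          exact (hbB l).trans this
        have h3 : (2 : ℝ) ^ (2 * q) = 2 ^ q * 2 ^ q := by ring
        have h4 : (2 : ℝ) ^ (g + κ + q) = 2 ^ g * 2 ^ κ * 2 ^ q := by ring
        have h5 : (2 : ℝ) ^ g * (2 * 2 ^ q) * 2 ^ q ≤ 2 ^ g * 2 ^ κ * 2 ^ q := by gcongr
        have h6 : (1 : ℝ) ≤ 2 ^ q * 2 ^ q := by nlinarith
        rw [h4]
        have h7 : (1 : ℝ) ≤ 2 ^ g * (2 ^ q * 2 ^ q) := by nlinarith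
        rw [h3] at h2
        rw [h3] at h1 ⊢
        nlinarith
      refine pack_mem_Ico _ _ (fun l => ?_) (fun l => ?_)
      · linarith [hβ l, neg_abs_le ((⌊2 ^ (2 * q) * b l⌋ : ℤ) : ℝ)]
      · rw [hoff]
        linarith [hβ l, le_abs_self ((⌊2 ^ (2 * q) * b l⌋ : ℤ) : ℝ)]
    obtain ⟨f₀, hf₀, ef₀⟩ := exists_isLayer_load c (by
      rw [abs_of_nonneg hc01.1]; linarith [hc01.2])
    -- The coefficient of the input `j` is the packed column `j` of the rounded weight matrix.
    refine ⟨fun j => pack (1 + g + κ + q) fun l => (⌊2 ^ q * W l j⌋ : ℝ), ?_, F ∘ f ∘ f₀, ?_, ?_⟩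
    · intro j
      have h1 : |pack (1 + g + κ + q) fun l => (⌊2 ^ q * W l j⌋ : ℝ)| ≤
          ∑ _l : Fin m', 2 ^ q * (2 * B) / 2 ^ (1 + g + κ + q) := by
        refine (Finset.abs_sum_le_sum_abs _ _).trans (Finset.sum_le_sum fun l _ => ?_)
        rw [abs_div, abs_of_pos (by positivity : (0 : ℝ) < 2 ^ ((1 + g + κ + q) * (l.val + 1)))]
        have h2 := hfl (2 ^ q * W l j)
        rw [abs_mul, abs_of_pos (by positivity : (0 : ℝ) < 2 ^ q)] at h2
        have h3 : (2 : ℝ) ^ q * |W l j| ≤ 2 ^ q * B := by gcongr; exact hWB l j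
        gcongr
        · nlinarith
        · norm_num
        · exact Nat.le_mul_of_pos_right _ (by omega)
      rw [Finset.sum_const, Finset.card_univ, Fintype.card_fin, nsmul_eq_mul] at h1
      have h2 : (m' : ℝ) * (2 ^ q * (2 * B) / 2 ^ (1 + g + κ + q)) ≤
          2 ^ g * 2 ^ q * 2 / 2 ^ (1 + g + κ + q) := by
        rw [← mul_div_assoc]
        have h3 : (m' : ℝ) ≤ n := by exact_mod_cast hm'n
        have h4 : (m' : ℝ) * B ≤ 2 ^ g := (by gcongr : (m' : ℝ) * B ≤ n * B).trans hnBg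
        have h5 : (m' : ℝ) * (2 ^ q * (2 * B)) = m' * B * 2 ^ q * 2 := by ring
        rw [h5]
        gcongr
      have h3 : (2 : ℝ) ^ g * 2 ^ q * 2 / 2 ^ (1 + g + κ + q) * 2 ^ κ = 1 := by
        rw [hoff, pow_add, pow_add]
        field_simp
      calc _ ≤ (2 : ℝ) ^ g * 2 ^ q * 2 / 2 ^ (1 + g + κ + q) * 2 ^ κ := by
            gcongr; exact h1.trans h2
        _ = 1 := h3
    · have h1 : m' * ((1 + g + κ + q) * (s + 4)) ≤ s * (s + 4) := by
        rw [← mul_assoc]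
        refine Nat.mul_le_mul_right _ ?_
        rw [hs]
        exact Nat.mul_le_mul_right _ hm'n
      refine ((hF.runs hf (by norm_num) (by norm_num)).layer (e := regEquiv 1) hf₀ (by norm_num)
        (by norm_num)).mono le_rfl ?_ ?_
      · rw [ReLUNet.depth, Nat.succ_mul N.depth]; omega
      · rw [ReLUNet.depth, Nat.succ_mul N.depth]; omega
    · intro x k hx0 hx hk z σ p r hp hr hpr
      set X : ℝ := 2 ^ (g * i) with hX
      have hX1 : 1 ≤ X := one_le_pow₀ (by norm_num)
      have hGX : (2 : ℝ) ^ g * X = 2 ^ (g * (i + 1)) := by rw [hX, ← pow_add]; ring_nf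
      set a : Fin m' → ℤ := fun l => ∑ j, ⌊2 ^ q * W l j⌋ * k j + ⌊2 ^ (2 * q) * b l⌋ with ha
      have hround := fun l => round_neuron hmn hn0 hB hg hX1 q (W l) (b l) (hWB l) (hbB l) x k
        hx0 hx hk (a l) rfl
      simp only [hGX] at hround
      have habs : ∀ l, |a l| < 2 ^ (κ + q) := fun l => by
        have h1 := (hround l).2.2
        have h2 : (2 : ℝ) ^ (2 * q) * (2 * 2 ^ (g * (i + 1))) ≤ 2 ^ (κ + q) := by
          rw [← pow_succ', ← pow_add]
          refine pow_le_pow_right₀ (by norm_num) ?_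
          have : g * (i + 1) ≤ g * D := Nat.mul_le_mul_left _ (by
            simp only [ReLUNet.depth] at hi; omega)
          omega
        exact_mod_cast h1.trans_le h2
      have hle : (2 : ℤ) ^ (κ + q) ≤ 2 ^ (g + κ + q) :=
        pow_le_pow_right₀ (by norm_num) (by omega)
      have ha0 : ∀ l, -2 ^ (g + κ + q) ≤ a l := fun l => by
        linarith [(abs_lt.1 (habs l)).1]
      have ha1 : ∀ l, a l < 2 ^ (κ + q) := fun l => (abs_lt.1 (habs l)).2
      have hpack : p - r + c = pack (1 + g + κ + q) fun l => (a l + 2 ^ (g + κ + q) : ℝ) := by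
        rw [hpr, hc, sum_mul_pack_add_pack]
        simp only [ha, Int.cast_add, Int.cast_sum, Int.cast_mul, Int.cast_natCast]
      have hpack0 : 0 ≤ pack (1 + g + κ + q) fun l => (a l + 2 ^ (g + κ + q) : ℝ) := by
        refine Finset.sum_nonneg fun l _ => div_nonneg ?_ (by positivity)
        have : -2 ^ (g + κ + q) ≤ (a l : ℝ) := by exact_mod_cast ha0 l
        linarith
      obtain ⟨z', σ', p', r', hp', hr', h1, h2⟩ := ef 0 0 0 a le_rfl le_rfl le_rfl ha0 ha1
      have h3 := e (fun l => relu (∑ j, W l j * x j + b l)) (fun l => (a l).toNat / 2 ^ q)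
        (fun l => relu_nonneg _) (fun l => (hround l).1) (fun l => (hround l).2.1)
        (fun _ => z') σ' p' r' hp' hr' (by rw [h2]; simp)
      simpa only [Function.comp_apply, ef₀, hpack, relu_of_nonneg hpack0, h1, ReLUNet.eval] using h3

/-! ### Reading the real inputs -/

/-- Translating the inputs only changes the first biases. -/
lemma exists_shift {d n : ℕ} {A B : ℝ} (hA : 1 ≤ A) (hB : 0 ≤ B) (hd : d ≤ n) (hn0 : 0 < n)
    (N : ReLUNet d) (hN : N.WeightsBoundedBy B) :
    ∃ N' : ReLUNet d, N'.width = N.width ∧ N'.depth = N.depth ∧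
      N'.WeightsBoundedBy (2 * n * A * B) ∧ ∀ x, N'.eval (fun j => x j + A) = N.eval x := by
  have hn1 : (1 : ℝ) ≤ n := by exact_mod_cast hn0
  have hnA : 1 ≤ n * A := by nlinarith
  have hBB : B ≤ 2 * n * A * B := by nlinarith
  have hmono : ∀ {m : ℕ} (M : ReLUNet m), M.WeightsBoundedBy B →
      M.WeightsBoundedBy (2 * n * A * B) := by
    intro m M
    induction M with
    | output w b => exact fun h => ⟨fun j => (h.1 j).trans hBB, h.2.trans hBB⟩
    | hidden hm W b M ih =>
      exact fun h => ⟨fun i j => (h.1 i j).trans hBB, fun i => (h.2.1 i).trans hBB, ih h.2.2⟩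
  have hbias : ∀ (w : Fin d → ℝ) (b : ℝ), (∀ j, |w j| ≤ B) → |b| ≤ B →
      |b - (∑ j, w j) * A| ≤ 2 * n * A * B := by
    intro w b hw hb
    have h1 : |∑ j, w j| ≤ n * B := by
      calc |∑ j, w j| ≤ ∑ j, |w j| := Finset.abs_sum_le_sum_abs _ _
        _ ≤ ∑ _j : Fin d, B := Finset.sum_le_sum fun j _ => hw j
        _ = d * B := by simp
        _ ≤ n * B := by gcongr
    calc |b - (∑ j, w j) * A| ≤ |b| + |(∑ j, w j) * A| := abs_sub _ _
      _ ≤ B + n * B * A := by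
          rw [abs_mul, abs_of_nonneg (by linarith : 0 ≤ A)]
          gcongr
      _ ≤ 2 * n * A * B := by nlinarith
  have hsum : ∀ (w x : Fin d → ℝ) (b : ℝ),
      ∑ j, w j * (x j + A) + (b - (∑ j, w j) * A) = ∑ j, w j * x j + b := by
    intro w x b
    simp only [mul_add, Finset.sum_add_distrib, Finset.sum_mul]
    ring
  cases N with
  | output w b =>
    exact ⟨.output w (b - (∑ j, w j) * A), rfl, rfl,
      ⟨fun j => (hN.1 j).trans hBB, hbias w b hN.1 hN.2⟩, fun x => hsum w x b⟩
  | hidden hm W b N =>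
    refine ⟨.hidden hm W (fun i => b i - (∑ j, W i j) * A) N, rfl, rfl,
      ⟨fun i j => (hN.1 i j).trans hBB, fun i => hbias (W i) (b i) (hN.1 i) (hN.2.1 i),
        hmono N hN.2.2⟩, fun x => ?_⟩
    rw [ReLUNet.eval, ReLUNet.eval]
    congr 1
    funext i
    rw [hsum (W i) x (b i)]

/-- A narrow network that reads `q + a` binary digits of all rescaled inputs in parallel and then
runs the simulation. It is accurate wherever all those digits are read off exactly. -/
lemma exists_narrow_net {n g q κ D s s₁ a d : ℕ} {A B : ℝ} (hn0 : 0 < n) (hB : 1 ≤ B)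
    (hg : 5 * n * B ≤ 2 ^ g) (hq : g * D ≤ q) (hκ : κ = q + g * D + 1) (hD : 0 < D)
    (hs : s = n * (1 + g + κ + q)) (hd : 0 < d) (hA : 0 < A) (hAa : 2 * A < 2 ^ a)
    (hAg : 2 * A ≤ 2 ^ g) (ha : q + a ≤ κ) (N : ReLUNet d) (hN : N.width ≤ n)
    (hNB : N.WeightsBoundedBy B) (hND : 1 + N.depth = D) :
    ∃ N' : ReLUNet d, N'.width ≤ max (5 * d) 10 ∧ N'.WeightsBoundedBy 2 ∧
      N'.depth ≤ (q + a) * (s₁ + 4) + 2 + N.depth * (s * (s + 4) + κ + 2) ∧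
      N'.numParams ≤ 30 * (d * d * ((q + a) * (s₁ + 4) + 2)) +
        30 * (N.depth * (s * (s + 4) + κ + 2)) ∧
      ∀ x : Fin d → ℝ, (∀ j, -A ≤ x j) → (∀ j, x j ≤ A) →
        (∀ j, RampAvoiding s₁ (q + a) ((x j + A) / 2 ^ a)) →
        |N'.eval x - N.eval (fun j => x j + A)| ≤ 2 ^ (g * D) / 2 ^ q := by
  have ha0 : (0 : ℝ) < 2 ^ a := by positivity
  obtain ⟨v, hv, F, hF, e⟩ := exists_realizes_simulation hn0 hB hg hq hκ hD hs N 1 hN hNB hND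
  obtain ⟨f₁, hf₁, e₁⟩ := exists_isLayer_input d (1 / 2 ^ a) (A / 2 ^ a)
    (by
      rw [abs_of_pos (by positivity), div_le_iff₀ ha0]
      have : (1 : ℝ) ≤ 2 ^ a := one_le_pow₀ (by norm_num)
      linarith)
    (by rw [abs_of_pos (by positivity), div_le_iff₀ ha0]; linarith)
  obtain ⟨f₂, hf₂, e₂⟩ := exists_runs_addDigits d s₁ (q + a) v fun j => by
    have h1 : (2 : ℝ) ^ (q + a) ≤ 2 ^ κ := pow_le_pow_right₀ (by norm_num) ha
    have h2 : |v j| * 2 ^ (q + a) ≤ |v j| * 2 ^ κ := by gcongr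
    linarith [hv j]
  obtain ⟨f₃, hf₃, e₃⟩ := exists_isLayer_handOver d
  have hw : 2 * d + 3 ≤ max (5 * d) 10 := le_max_of_le_left (by omega)
  have h3 := (hF.mono (le_max_of_le_right (by norm_num) : 5 ≤ max (5 * d) 10) le_rfl le_rfl).layer
    (e := regEquiv d) hf₃ hw (by norm_num)
  obtain ⟨N', hN'w, hN'B, hN'd, hN'p, hN'e⟩ := (h3.runs hf₂ hw (by omega)).layer
    (e := Equiv.refl (Fin d)) hf₁ (le_max_of_le_left (by omega)) (by omega)
  refine ⟨N', hN'w, hN'B, by linarith, hN'p.trans ?_, fun x hx0 hx1 hx => ?_⟩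
  · have hd2 : 2 * d + 3 ≤ 5 * d := by omega
    have hd3 : 2 * d + 3 + 1 ≤ 6 * d := by omega
    have hdd : d ≤ d * d := Nat.le_mul_of_pos_left d hd
    have e1 : (2 * d + 3) * (2 * d + 3) + (2 * d + 3) ≤ 30 * (d * d) := by
      calc (2 * d + 3) * (2 * d + 3) + (2 * d + 3) = (2 * d + 3) * (2 * d + 3 + 1) := by ring
        _ ≤ (5 * d) * (6 * d) := Nat.mul_le_mul hd2 hd3
        _ = 30 * (d * d) := by ring
    have e2 := Nat.mul_le_mul_left ((q + a) * (s₁ + 4)) e1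
    have e3 : (2 * d + 3) * d ≤ 5 * (d * d) := by
      calc (2 * d + 3) * d ≤ 5 * d * d := Nat.mul_le_mul_right _ hd2
        _ = 5 * (d * d) := by ring
    have e4 : 30 * (d * d * ((q + a) * (s₁ + 4) + 2)) =
      (q + a) * (s₁ + 4) * (30 * (d * d)) + 60 * (d * d) := by ring
    have e5 : 1 ≤ d * d := hd.trans_le hdd
    omega
  · set z : Fin d → ℝ := fun j => (x j + A) / 2 ^ a with hz
    have hz0 : ∀ j, 0 ≤ z j := fun j => div_nonneg (by linarith [hx0 j]) ha0.le
    have hz1 : ∀ j, z j < 1 := fun j => by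
      rw [hz, div_lt_one ha0]; linarith [hx1 j]
    have hin : f₁ x = regs z 0 1 0 0 := by
      rw [e₁]
      congr 1
      funext j
      rw [show 1 / 2 ^ a * x j + A / 2 ^ a = z j by rw [hz]; ring, relu_of_nonneg (hz0 j)]
    obtain ⟨p, m, hp, hm, h1, h2⟩ := e₂ z 1 0 0 hz0 hz1 (Or.inr rfl) le_rfl le_rfl hx
    have hfl : ∀ j, ((⌊2 ^ (q + a) * z j⌋₊ : ℕ) : ℝ) = (⌊2 ^ (q + a) * z j⌋ : ℝ) := fun j =>
      natCast_floor_eq_intCast_floor (mul_nonneg (by positivity) (hz0 j))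
    have hzx : ∀ j, 2 ^ (q + a) * z j = 2 ^ q * (x j + A) := fun j => by
      rw [hz, pow_add]; field_simp
    have key := e (fun j => x j + A) (fun j => ⌊2 ^ (q + a) * z j⌋₊)
      (fun j => by linarith [hx0 j])
      (fun j => by rw [mul_one]; linarith [hx1 j])
      (fun j => by
        have h5 : (1 : ℝ) ≤ 2 ^ (g * 1) := one_le_pow₀ (by norm_num)
        refine le_trans ?_ h5
        rw [hfl, ← hzx, abs_le]
        constructor <;> linarith [Int.floor_le (2 ^ (q + a) * z j),
          Int.lt_floor_add_one (2 ^ (q + a) * z j)])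
      0 0 p m hp hm (by
        rw [h2]
        simp only [hfl, sub_zero, zero_add, one_mul]
        exact Finset.sum_congr rfl fun j _ => mul_comm _ _)
    have hev := hN'e x
    simp only [Equiv.refl_symm, Equiv.coe_refl, Function.comp_id, Function.comp_apply, hin, h1,
      e₃ _ _ _ p m hp hm] at hev
    rw [hev]
    exact key

/-! ### The exceptional set -/

open MeasureTheory

/-- Points where a digit is not read off exactly lie immediately below a dyadic rational. -/
lemma exists_mem_Ioo_of_not_rampAvoiding {s l : ℕ} {z : ℝ} (h0 : 0 ≤ z) (h1 : z < 1)
    (h : ¬ RampAvoiding s l z) :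
    ∃ m ∈ Finset.range (2 ^ l + 1), z ∈ Set.Ioo ((m : ℝ) / 2 ^ l - 1 / 2 ^ s) (m / 2 ^ l) := by
  unfold RampAvoiding at h
  push Not at h
  obtain ⟨t, ht, h2, h3⟩ := h
  obtain ⟨r, rfl⟩ := Nat.exists_eq_add_of_lt ht
  have ht0 : (0 : ℝ) < 2 ^ t := by positivity
  have hz := Int.floor_add_fract (2 ^ t * z)
  obtain ⟨K, hK⟩ : ∃ K : ℕ, ⌊2 ^ t * z⌋ = K :=
    Int.eq_ofNat_of_zero_le (Int.floor_nonneg.2 (by positivity))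
  rw [hK, Int.cast_natCast] at hz
  have hK1 : K < 2 ^ t := by
    have : (K : ℝ) < 2 ^ t := by
      have := Int.fract_nonneg (2 ^ t * z)
      nlinarith
    exact_mod_cast this
  have hm : (((2 * K + 1) * 2 ^ r : ℕ) : ℝ) / 2 ^ (t + r + 1) = (K + 1 / 2) / 2 ^ t := by
    push_cast
    rw [pow_succ, pow_add]
    field_simp
  refine ⟨(2 * K + 1) * 2 ^ r, ?_, ?_⟩
  · rw [Finset.mem_range, Nat.lt_succ_iff]
    calc (2 * K + 1) * 2 ^ r ≤ (2 * 2 ^ t) * 2 ^ r := Nat.mul_le_mul_right _ (by omega)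
      _ = 2 ^ (t + r + 1) := by ring
  · rw [hm]
    have hs : (1 : ℝ) / 2 ^ s / 2 ^ t ≤ 1 / 2 ^ s :=
      div_le_self (by positivity) (one_le_pow₀ (by norm_num))
    constructor
    · have h4 : (K + 1 / 2) / 2 ^ t - 1 / 2 ^ s / 2 ^ t < z := by
        rw [← sub_div, div_lt_iff₀ ht0]; linarith
      linarith
    · rw [lt_div_iff₀ ht0]; linarith

lemma HasBoundedDensityOnCube.measureReal_compl_cube {d : ℕ} {D : Measure (Fin d → ℝ)} {A β : ℝ}
    {p : (Fin d → ℝ) → ℝ} (h : HasBoundedDensityOnCube D A p β) : D.real (cube d A)ᶜ = 0 := by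
  have hcube : MeasurableSet (cube d A) := measurableSet_Icc
  have h1 : D (cube d A)ᶜ = 0 := by
    rw [h.eq_withDensity]
    refine withDensity_absolutelyContinuous _ _ ?_
    rw [Measure.restrict_apply hcube.compl, Set.compl_inter_self, measure_empty]
  rw [measureReal_def, h1, ENNReal.toReal_zero]

/-- The mass of a slab orthogonal to a coordinate axis. -/
lemma HasBoundedDensityOnCube.measureReal_slab_le {d : ℕ} {D : Measure (Fin d → ℝ)} {A β : ℝ}
    {p : (Fin d → ℝ) → ℝ} (h : HasBoundedDensityOnCube D A p β) (hA : 0 ≤ A) (hβ : 0 ≤ β)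
    (j : Fin d) (u v : ℝ) (huv : u ≤ v) :
    D.real {x | x j ∈ Set.Ioo u v} ≤ β * ((v - u) * (2 * A) ^ (d - 1)) := by
  classical
  set S : Set (Fin d → ℝ) := {x | x j ∈ Set.Ioo u v} with hS
  have hSm : MeasurableSet S := measurableSet_Ioo.preimage (measurable_pi_apply j)
  have hcube : MeasurableSet (cube d A) := measurableSet_Icc
  refine ENNReal.toReal_le_of_le_ofReal
    (mul_nonneg hβ (mul_nonneg (sub_nonneg.2 huv) (by positivity))) ?_
  have hsub : S ∩ cube d A ⊆
      Set.univ.pi fun i => if i = j then Set.Ioo u v else Set.Icc (-A) A := by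
    rintro x ⟨hx, hx'⟩ i -
    by_cases hi : i = j
    · subst hi; simpa [hS] using hx
    · simp only [hi, if_false]; exact ⟨hx'.1 i, hx'.2 i⟩
  have hvol : volume (S ∩ cube d A) ≤ ENNReal.ofReal ((v - u) * (2 * A) ^ (d - 1)) := by
    refine (measure_mono hsub).trans (le_of_eq ?_)
    rw [volume_pi_pi, ← Finset.mul_prod_erase Finset.univ _ (Finset.mem_univ j),
      Finset.prod_congr rfl (g := fun _ => ENNReal.ofReal (2 * A))]
    · simp only [if_true, Real.volume_Ioo, Finset.prod_const]
      rw [Finset.card_erase_of_mem (Finset.mem_univ j), Finset.card_univ, Fintype.card_fin,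
        ← ENNReal.ofReal_pow (by positivity), ← ENNReal.ofReal_mul (sub_nonneg.2 huv)]
    · intro i hi
      rw [if_neg (Finset.ne_of_mem_erase hi), Real.volume_Icc]
      congr 1
      ring
  calc D S = ∫⁻ x in S ∩ cube d A, ENNReal.ofReal (p x) := by
        conv_lhs => rw [h.eq_withDensity]
        rw [withDensity_apply _ hSm, Measure.restrict_restrict hSm]
    _ ≤ ∫⁻ _x in S ∩ cube d A, ENNReal.ofReal β :=
        setLIntegral_mono measurable_const fun x hx => ENNReal.ofReal_le_ofReal (h.le_bound x hx.2)
    _ = ENNReal.ofReal β * volume (S ∩ cube d A) := setLIntegral_const _ _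
    _ ≤ ENNReal.ofReal β * ENNReal.ofReal ((v - u) * (2 * A) ^ (d - 1)) := by gcongr
    _ = ENNReal.ofReal (β * ((v - u) * (2 * A) ^ (d - 1))) := (ENNReal.ofReal_mul hβ).symm

/-- Union bound over all coordinates and all dyadic rationals with `l` digits. -/
lemma HasBoundedDensityOnCube.one_sub_le_measureReal {d : ℕ} {D : Measure (Fin d → ℝ)} {A β : ℝ}
    {p : (Fin d → ℝ) → ℝ} (h : HasBoundedDensityOnCube D A p β) (hA : 0 ≤ A) (hβ : 0 ≤ β)
    {s l a : ℕ} (hAa : 2 * A < 2 ^ a) {T : Set (Fin d → ℝ)}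
    (hT : ∀ x, (∀ j, -A ≤ x j) → (∀ j, x j ≤ A) →
      (∀ j, RampAvoiding s l ((x j + A) / 2 ^ a)) → x ∈ T) :
    1 - d * ((2 ^ l + 1) * (β * (2 ^ a / 2 ^ s * (2 * A) ^ (d - 1)))) ≤ D.real T := by
  have := h.isProbabilityMeasure
  have ha0 : (0 : ℝ) < 2 ^ a := by positivity
  let S : Fin d → ℕ → Set (Fin d → ℝ) := fun j m =>
    {x | x j ∈ Set.Ioo (2 ^ a * (m / 2 ^ l - 1 / 2 ^ s) - A : ℝ) (2 ^ a * (m / 2 ^ l) - A)}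
  have hS : ∀ j m, D.real (S j m) ≤ β * (2 ^ a / 2 ^ s * (2 * A) ^ (d - 1)) := by
    intro j m
    have hpos : (0 : ℝ) ≤ 2 ^ a * (1 / 2 ^ s) := by positivity
    refine (h.measureReal_slab_le hA hβ j _ _ (by linarith)).trans (le_of_eq ?_)
    congr 2
    ring
  have hcover : Set.univ ⊆ (T ∪ ⋃ j ∈ Finset.univ, ⋃ m ∈ Finset.range (2 ^ l + 1), S j m) ∪
      (cube d A)ᶜ := by
    intro x _
    by_cases hx : x ∈ cube d A
    · refine Or.inl ?_
      by_cases hav : ∀ j, RampAvoiding s l ((x j + A) / 2 ^ a)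
      · exact Or.inl (hT x (fun j => hx.1 j) (fun j => hx.2 j) hav)
      · right
        push Not at hav
        obtain ⟨j, hj⟩ := hav
        have hx0 : -A ≤ x j := hx.1 j
        have hx1 : x j ≤ A := hx.2 j
        obtain ⟨m, hm, h1, h2⟩ := exists_mem_Ioo_of_not_rampAvoiding
          (div_nonneg (by linarith) ha0.le) (by rw [div_lt_one ha0]; linarith) hj
        simp only [Set.mem_iUnion]
        rw [lt_div_iff₀ ha0] at h1
        rw [div_lt_iff₀ ha0] at h2
        exact ⟨j, Finset.mem_univ j, m, hm, by linarith, by linarith⟩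
    · exact Or.inr hx
  have h1 : (1 : ℝ) ≤ D.real T +
      D.real (⋃ j ∈ Finset.univ, ⋃ m ∈ Finset.range (2 ^ l + 1), S j m) := by
    calc (1 : ℝ) = D.real Set.univ := probReal_univ.symm
      _ ≤ _ := measureReal_mono hcover
      _ ≤ _ := measureReal_union_le _ _
      _ ≤ _ := add_le_add_left (measureReal_union_le _ _) _
      _ = _ := by rw [h.measureReal_compl_cube, add_zero]
  have h2 : D.real (⋃ j ∈ Finset.univ, ⋃ m ∈ Finset.range (2 ^ l + 1), S j m) ≤
      ∑ _j : Fin d, ∑ _m ∈ Finset.range (2 ^ l + 1),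
        β * (2 ^ a / 2 ^ s * (2 * A) ^ (d - 1)) := by
    refine (measureReal_biUnion_finset_le _ _).trans (Finset.sum_le_sum fun j _ => ?_)
    exact (measureReal_biUnion_finset_le _ _).trans (Finset.sum_le_sum fun m _ => hS j m)
  simp only [Finset.sum_const, Finset.card_univ, Fintype.card_fin, Finset.card_range,
    nsmul_eq_mul] at h2
  push_cast at h2
  linarith

/-! ### Choice of the parameters -/

/-- The size of the network that `exists_narrow_net` provides, with all parameters
expressed through `n`, `L` and the number `lam` of binary digits of the data of the problem. -/
lemma size_le {n L d lam g q κ s s₁ : ℕ} (hn : 0 < n) (hL : 0 < L) (hlam : 0 < lam) (hd : d ≤ n)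
    (hg : g = 2 * lam + 3) (hq : q = g * (1 + L) + lam) (hκ : κ = q + g * (1 + L) + 1)
    (hs : s = n * (1 + g + κ + q)) (hs₁ : s₁ = q + (lam + 1) + n * lam + 4 * lam + 3) :
    30 * (d * d * ((q + (lam + 1)) * (s₁ + 4) + 2)) + 30 * (L * (s * (s + 4) + κ + 2)) ≤
      61000 * (n ^ 3 * L ^ 3 * lam ^ 2) := by
  set t := L * lam with ht
  have ht1 : 1 ≤ t := Nat.mul_pos hL hlam
  have hlt : lam ≤ t := Nat.le_mul_of_pos_left _ hL
  have hgD : g * (1 + L) ≤ 10 * t := by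
    calc g * (1 + L) ≤ (5 * lam) * (2 * L) := Nat.mul_le_mul (by omega) (by omega)
      _ = 10 * t := by rw [ht]; ring
  have hnt : t ≤ n * t := Nat.le_mul_of_pos_left _ hn
  have hs2 : s ≤ 39 * (n * t) := by
    calc s ≤ n * (39 * t) := by rw [hs]; exact Nat.mul_le_mul_left _ (by omega)
      _ = 39 * (n * t) := by ring
  have hnl : n * lam ≤ n * t := Nat.mul_le_mul_left _ hlt
  have h1 : (q + (lam + 1)) * (s₁ + 4) + 2 ≤ 327 * (n * t * t) := by
    calc (q + (lam + 1)) * (s₁ + 4) + 2 ≤ (13 * t) * (25 * (n * t)) + 2 * (n * t * t) := by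
          refine Nat.add_le_add (Nat.mul_le_mul (by omega) (by omega)) ?_
          have : 1 ≤ n * t * t := Nat.mul_pos (by omega) ht1
          omega
      _ = 327 * (n * t * t) := by ring
  have h2 : s * (s + 4) + κ + 2 ≤ 1701 * (n * t * (n * t)) := by
    have h3 : n * t ≤ n * t * (n * t) := Nat.le_mul_of_pos_left _ (by omega)
    have h4 : s * (s + 4) ≤ (39 * (n * t)) * (43 * (n * t)) := Nat.mul_le_mul hs2 (by omega)
    have h5 : (39 * (n * t)) * (43 * (n * t)) = 1677 * (n * t * (n * t)) := by ring
    omega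
  have h3 : d * d * ((q + (lam + 1)) * (s₁ + 4) + 2) ≤ 327 * (n ^ 3 * L ^ 3 * lam ^ 2) := by
    calc _ ≤ n * n * (327 * (n * t * t)) := Nat.mul_le_mul (Nat.mul_le_mul hd hd) h1
      _ = 327 * (n ^ 3 * L ^ 2 * lam ^ 2) := by rw [ht]; ring
      _ ≤ 327 * (n ^ 3 * L ^ 3 * lam ^ 2) := by
          gcongr
          · omega
  have h4 : L * (s * (s + 4) + κ + 2) ≤ 1701 * (n ^ 3 * L ^ 3 * lam ^ 2) := by
    calc _ ≤ L * (1701 * (n * t * (n * t))) := Nat.mul_le_mul_left _ h2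
      _ = 1701 * (n ^ 2 * L ^ 3 * lam ^ 2) := by rw [ht]; ring
      _ ≤ 1701 * (n ^ 3 * L ^ 3 * lam ^ 2) := by
          gcongr
          · omega
  omega

/-- A number `Y ≥ 2` has at most about `log Y` binary digits. -/
lemma exists_le_two_pow {Y : ℝ} (hY : 2 ≤ Y) :
    ∃ lam : ℕ, 0 < lam ∧ Y ≤ 2 ^ lam ∧ (lam : ℝ) ≤ 3 * Real.log Y := by
  have h2 := Real.log_two_gt_d9
  have hl : Real.log 2 ≤ Real.log Y := Real.log_le_log (by norm_num) hY
  have hpos : 0 < Real.log Y / Real.log 2 := div_pos (by linarith) (by linarith)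
  refine ⟨⌈Real.log Y / Real.log 2⌉₊, Nat.ceil_pos.2 hpos, ?_, ?_⟩
  · rw [← Real.log_le_log_iff (by linarith) (by positivity), Real.log_pow,
      ← div_le_iff₀ (by linarith)]
    exact Nat.le_ceil _
  · have h3 := Nat.ceil_lt_add_one hpos.le
    have h4 : Real.log Y / Real.log 2 ≤ Real.log Y / 0.69 := by
      gcongr
      · linarith
      · linarith
    have h5 : Real.log Y / 0.69 + 1 ≤ 3 * Real.log Y := by
      rw [div_eq_mul_inv]
      norm_num
      linarith
    linarith

/-- The exceptional set is small once the ramps are steep enough. -/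
lemma exceptional_lt {n d lam l s a : ℕ} {A β δ : ℝ} (hd : d ≤ n) (hδ : 0 < δ) (hβ0 : 0 ≤ β)
    (hA0 : 0 ≤ A) (hA : 2 * A ≤ 2 ^ lam) (hn : (n : ℝ) ≤ 2 ^ lam) (hβ : β ≤ 2 ^ lam)
    (hδ' : 1 / δ ≤ 2 ^ lam) (ha : a = lam + 1) (hs : s = l + n * lam + 4 * lam + 3) :
    d * ((2 ^ l + 1) * (β * (2 ^ a / 2 ^ s * (2 * A) ^ (d - 1)))) < δ := by
  have hdn : (d : ℝ) ≤ 2 ^ lam := le_trans (by exact_mod_cast hd) hn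
  have hl : (2 : ℝ) ^ l + 1 ≤ 2 * 2 ^ l := by
    have : (1 : ℝ) ≤ 2 ^ l := one_le_pow₀ (by norm_num)
    linarith
  have hAd : (2 * A) ^ (d - 1) ≤ 2 ^ (n * lam) := by
    calc (2 * A) ^ (d - 1) ≤ ((2 : ℝ) ^ lam) ^ (d - 1) := by gcongr
      _ = 2 ^ (lam * (d - 1)) := (pow_mul _ _ _).symm
      _ ≤ 2 ^ (n * lam) := by
          refine pow_le_pow_right₀ (by norm_num) ?_
          rw [mul_comm]
          exact Nat.mul_le_mul_right _ (by omega)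
  have h1 : 1 / 2 ^ lam ≤ δ := by
    rw [div_le_iff₀ (by positivity)]
    rw [div_le_iff₀ hδ] at hδ'
    linarith
  calc d * ((2 ^ l + 1) * (β * (2 ^ a / 2 ^ s * (2 * A) ^ (d - 1))))
      ≤ 2 ^ lam * ((2 * 2 ^ l) * (2 ^ lam * (2 ^ a / 2 ^ s * 2 ^ (n * lam)))) := by gcongr
    _ = 1 / 2 ^ lam / 2 := by
        rw [ha, hs]
        simp only [pow_add, pow_one]
        rw [show 4 * lam = lam * 4 by ring, pow_mul _ lam 4]
        field_simp
    _ < 1 / 2 ^ lam := half_lt_self (by positivity)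
    _ ≤ δ := h1

theorem corollary3p2 :
    ∃ C : ℝ, 0 < C ∧
      ∀ (A B n L d : ℕ) (ε δ β : ℝ),
        0 < A → 0 < B → 0 < d → 0 < ε → 0 < δ → 0 < β →
        ∀ N₀ : ReLUNet d,
          N₀.width = n → N₀.depth = L → N₀.WeightsBoundedBy (B : ℝ) →
          ∀ (D : MeasureTheory.Measure (Fin d → ℝ)) (p : (Fin d → ℝ) → ℝ),
            HasBoundedDensityOnCube D (A : ℝ) p β →
            ∃ N : ReLUNet d,
              N.width ≤ max (5 * d) 10 ∧
              N.WeightsBoundedBy 2 ∧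
              (N.depth : ℝ) ≤ C * ((n : ℝ) ^ 3 * (L : ℝ) ^ 3 *
                Real.log (2 * A * B * n * max 1 β * max 1 (1 / ε) * max 1 (1 / δ)) ^ 2) ∧
              (N.numParams : ℝ) ≤ C * ((n : ℝ) ^ 3 * (L : ℝ) ^ 3 *
                Real.log (2 * A * B * n * max 1 β * max 1 (1 / ε) * max 1 (1 / δ)) ^ 2) ∧
              1 - δ < D.real {x | |N.eval x - N₀.eval x| ≤ ε} := by
  refine ⟨61000 * 9, by norm_num, ?_⟩
  intro A B n L d ε δ β hA hB hd hε hδ hβ N₀ hw hL hNB D p hD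
  have hdn : d ≤ n := by
    rw [← hw]; cases N₀ <;> simp [ReLUNet.width]
  have hn : 0 < n := hd.trans_le hdn
  have hL0 : 0 < L := by
    rw [← hL]; cases N₀ <;> simp [ReLUNet.depth]
  have hA1 : (1 : ℝ) ≤ A := by exact_mod_cast hA
  have hB1 : (1 : ℝ) ≤ B := by exact_mod_cast hB
  have hn1 : (1 : ℝ) ≤ n := by exact_mod_cast hn
  set Y : ℝ := 2 * A * B * n * max 1 β * max 1 (1 / ε) * max 1 (1 / δ)
  have hAB : (1 : ℝ) ≤ A * B := one_le_mul_of_one_le_of_one_le hA1 hB1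
  have hABn : (1 : ℝ) ≤ A * B * n := one_le_mul_of_one_le_of_one_le hAB hn1
  have hβ1 : 1 ≤ max 1 β := le_max_left _ _
  have hε1 : 1 ≤ max 1 (1 / ε) := le_max_left _ _
  have hδ1 : 1 ≤ max 1 (1 / δ) := le_max_left _ _
  have hu : (2 : ℝ) ≤ 2 * A * B * n := by nlinarith
  have hY1 : 2 * A * B * n ≤ 2 * A * B * n * max 1 β := le_mul_of_one_le_right (by linarith) hβ1
  have hY2 : 2 * A * B * n * max 1 β ≤ 2 * A * B * n * max 1 β * max 1 (1 / ε) :=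
    le_mul_of_one_le_right (by linarith) hε1
  have hY3 : 2 * A * B * n * max 1 β * max 1 (1 / ε) ≤ Y :=
    le_mul_of_one_le_right (by linarith) hδ1
  obtain ⟨lam, hlam, hYlam, hlamY⟩ := exists_le_two_pow (by linarith : 2 ≤ Y)
  have hu' : 2 * A * B * n ≤ (2 : ℝ) ^ lam := by linarith
  have hA2 : 2 * (A : ℝ) ≤ 2 ^ lam := by
    refine le_trans ?_ hu'
    have : (1 : ℝ) ≤ B * n := one_le_mul_of_one_le_of_one_le hB1 hn1
    nlinarith
  have hn2 : (n : ℝ) ≤ 2 ^ lam := by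
    refine le_trans ?_ hu'
    nlinarith
  have hβ2 : β ≤ 2 ^ lam := by
    have : β ≤ max 1 β := le_max_right _ _
    nlinarith
  have hε2 : 1 / ε ≤ 2 ^ lam := by
    have : 1 / ε ≤ max 1 (1 / ε) := le_max_right _ _
    nlinarith
  have hδ2 : 1 / δ ≤ 2 ^ lam := by
    have : 1 / δ ≤ max 1 (1 / δ) := le_max_right _ _
    have h1 : max 1 (1 / δ) ≤ Y := le_mul_of_one_le_left (by linarith) (by linarith)
    linarith
  obtain ⟨N₁, hN₁w, hN₁d, hN₁B, hN₁e⟩ :=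
    exists_shift (n := n) hA1 (by linarith) hdn hn N₀ hNB
  rw [hw] at hN₁w
  rw [hL] at hN₁d
  have hB' : (1 : ℝ) ≤ 2 * n * A * B := by
    have : 2 * (n : ℝ) * A * B = 2 * A * B * n := by ring
    linarith
  have hlam1 : (1 : ℝ) ≤ 2 ^ lam := one_le_pow₀ (by norm_num)
  have hgn : 5 * n * (2 * n * A * B) ≤ (2 : ℝ) ^ (2 * lam + 3) := by
    have h1 : (2 : ℝ) ^ (2 * lam + 3) = 8 * (2 ^ lam * 2 ^ lam) := by ring
    have h2 : (n : ℝ) * (2 * A * B * n) ≤ 2 ^ lam * 2 ^ lam := by gcongr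
    rw [h1]
    nlinarith
  have hAg : 2 * (A : ℝ) ≤ 2 ^ (2 * lam + 3) :=
    hA2.trans (pow_le_pow_right₀ (by norm_num) (by omega))
  -- Growth per layer `2 ^ g`; fractional digits `q`, so that the final error is `2 ^ (-lam)`; digits
  -- `κ` of an activation; ramp exponents `s` for the simulation and `s₁` for the real inputs.
  obtain ⟨g, hg⟩ : ∃ g, g = 2 * lam + 3 := ⟨_, rfl⟩
  rw [← hg] at hgn hAg
  obtain ⟨q, hq⟩ : ∃ q, q = g * (1 + L) + lam := ⟨_, rfl⟩
  obtain ⟨κ, hκ⟩ : ∃ κ, κ = q + g * (1 + L) + 1 := ⟨_, rfl⟩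
  obtain ⟨s, hs⟩ : ∃ s, s = n * (1 + g + κ + q) := ⟨_, rfl⟩
  obtain ⟨s₁, hs₁⟩ : ∃ s₁, s₁ = q + (lam + 1) + n * lam + 4 * lam + 3 := ⟨_, rfl⟩
  have hAa : 2 * (A : ℝ) < 2 ^ (lam + 1) := by rw [pow_succ]; linarith
  have hgD : g ≤ g * (1 + L) := Nat.le_mul_of_pos_right _ (by omega)
  obtain ⟨N, hNw, hNB2, hNd, hNp, hNe⟩ := exists_narrow_net (s₁ := s₁) (a := lam + 1) hn hB' hgn
    (by omega : g * (1 + L) ≤ q) hκ (by omega) hs hd (by linarith) hAa hAg (by omega) N₁ hN₁w.le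
    hN₁B (by rw [hN₁d])
  rw [hN₁d] at hNd hNp
  have hsize := size_le hn hL0 hlam hdn hg hq hκ hs hs₁
  have hreal : ((61000 * (n ^ 3 * L ^ 3 * lam ^ 2) : ℕ) : ℝ) ≤
      61000 * 9 * ((n : ℝ) ^ 3 * (L : ℝ) ^ 3 * Real.log Y ^ 2) := by
    push_cast
    have h1 : (lam : ℝ) ^ 2 ≤ (3 * Real.log Y) ^ 2 := by gcongr
    have h2 : (n : ℝ) ^ 3 * (L : ℝ) ^ 3 * (lam : ℝ) ^ 2 ≤
        (n : ℝ) ^ 3 * (L : ℝ) ^ 3 * (3 * Real.log Y) ^ 2 := by gcongr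
    linarith
  refine ⟨N, hNw, hNB2, ?_, ?_, ?_⟩
  · have h1 : (q + (lam + 1)) * (s₁ + 4) + 2 ≤ d * d * ((q + (lam + 1)) * (s₁ + 4) + 2) :=
      Nat.le_mul_of_pos_left _ (Nat.mul_pos hd hd)
    exact le_trans (by exact_mod_cast (by omega : N.depth ≤ _)) hreal
  · exact le_trans (by exact_mod_cast hNp.trans hsize) hreal
  · refine lt_of_lt_of_le ?_ (hD.one_sub_le_measureReal (s := s₁) (l := q + (lam + 1))
      (by linarith) hβ.le hAa fun x hx0 hx1 hx => ?_)
    · have := exceptional_lt (l := q + (lam + 1)) (s := s₁) hdn hδ hβ.le (by linarith) hA2 hn2 hβ2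
        hδ2 rfl hs₁
      linarith
    · have h1 := hNe x hx0 hx1 hx
      rw [hN₁e] at h1
      refine h1.trans ?_
      -- `2 ^ (g * (1 + L)) / 2 ^ q = 2 ^ (-lam)` by the choice of `q`.
      rw [hq, pow_add, div_mul_cancel_left₀ (by positivity), inv_le_comm₀ (by positivity) hε]
      simpa using hε2
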